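/- Fix $\alpha\in[0,1]$. For a measure $\mu$ write $\mu_{\mathrm{ac}}$, $\mu_{\mathrm{sing}}$ for its absolutely continuous and singular parts with respect to Lebesgue measure. Let $\chi^{+}+\chi^{-}=1$ be a smooth partition of unity on $\mathbb R$ with $0\le\chi^\pm\le1$, $\operatorname{supp}\chi^+\subset(-1,\infty)$, $\operatorname{supp}\chi^-\subset(-\infty,1)$, and put $E_2=\{\bar f+a\chi^++b\chi^-:\bar f\in H^1(\mathbb R),\ a,b\in\mathbb R\}$ and $E_1^0=\{\bar f+a\chi^+:\bar f\in L^2(\mathbb R),\ a\in\mathbb R\}$ (neither space depends on the choice of $\chi^\pm$; elements of $E_2$ are identified with their continuous representatives). Let $\mathcal D$ be the set of triplets $(u,\mu,\nu)$ such that $u\in E_2$; $\mu\le\nu$ are finite positive Borel measures on $\mathbb R$; $\mu_{\mathrm{ac}}\le\nu_{\mathrm{ac}}$; $d\mu_{\mathrm{ac}}=u_x^2\,dx$; $\mu((-\infty,\cdot))$ and $\nu((-\infty,\cdot))$ belong to $E_1^0$; if $\alpha=1$, then $d\nu_{\mathrm{ac}}=d\mu=u_x^2\,dx$; and if $\alpha<1$,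 then $\frac{d\mu}{d\nu}\in\{1-\alpha,1\}$ $\nu$-a.e. and $\frac{d\mu_{\mathrm{ac}}}{d\nu_{\mathrm{ac}}}=1$ $\nu_{\mathrm{ac}}$-a.e. where $u_x<0$. Let $\mathcal D_0=\{(u,\mu,\nu)\in\mathcal D:\mu=\nu\}$. For $(u,\mu,\nu)\in\mathcal D$ define $L((u,\mu,\nu))=(y,U,V,H)$ by $$y(\xi)=\sup\{x:\nu((-\infty,x))+x<\xi\},\quad U(\xi)=u(y(\xi)),\quad H(\xi)=\xi-y(\xi),\quad V(\xi)=\int_{-\infty}^{\xi}\frac{d\mu}{d\nu}(y(\eta))H_\xi(\eta)\,d\eta .$$ For $X=(y,U,V,H)$ in the image of $L$ define, for a.e. $\xi$, $g(X)(\xi)=(1-\alpha)V_\xi(\xi)$ if $U_\xi(\xi)<0$, and $g(X)(\xi)=V_\xi(\xi)$ otherwise. For $\Delta x>0$ put $x_i=i\Delta x$, $i\in\mathbb Z$. Let $(u,\mu,\nu)\in\mathcal D_0$, $F(x)=\mu((-\infty,x))$, $F_{\mathrm{ac}}(x)=\mu_{\mathrm{ac}}((-\infty,x))$, $Df_{2j}=\frac{f(x_{2j+2})-f(x_{2j})}{2\Delta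 x}$ and $q_{2j}=\sqrt{DF_{\mathrm{ac},2j}-(Du_{2j})^2}$. Choose signs $\sigma_{2j}\in\{-1,1\}$, arbitrarily for every $\Delta x$ and $j$. The projection $P_{\Delta x}((u,\mu,\nu))=(u_{\Delta x},\mu_{\Delta x},\mu_{\Delta x})$ is given by $$u_{\Delta x}(x)=\begin{cases}u(x_{2j})+(Du_{2j}+\sigma_{2j}q_{2j})(x-x_{2j}),&x_{2j}<x\le x_{2j+1},\\ u(x_{2j+2})+(Du_{2j}-\sigma_{2j}q_{2j})(x-x_{2j+2}),&x_{2j+1}<x\le x_{2j+2},\end{cases}$$ and $\mu_{\Delta x}((-\infty,x))=F_{\Delta x,\mathrm{ac}}(x)+F_{\Delta x,\mathrm{sing}}(x)$, where $F_{\Delta x,\mathrm{sing}}(x)=F(x_{2j+2})-F_{\mathrm{ac}}(x_{2j+2})$ for $x_{2j}<x\le x_{2j+2}$ and $$F_{\Delta x,\mathrm{ac}}(x)=\begin{cases}F_{\mathrm{ac}}(x_{2j})+(Du_{2j}+\sigma_{2j}q_{2j})^2(x-x_{2j}),&x_{2j}<x\le x_{2j+1},\\ \tfrac{F_{\mathrm{ac}}(x_{2j+2})+F_{\mathrm{ac}}(x_{2j})}{2}+2\sigma_{2j}q_{2j}Du_{2j}\,\Delta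 x+(Du_{2j}-\sigma_{2j}q_{2j})^2(x-x_{2j+1}),&x_{2j+1}<x\le x_{2j+2}.\end{cases}$$ **Claim.** Let $(u,\mu,\nu)\in\mathcal D_0$, $X=L((u,\mu,\nu))$ and $X_{\Delta x}=L(P_{\Delta x}((u,\mu,\nu)))$. Then $g(X)$ and $g(X_{\Delta x})$, for every $\Delta x>0$, belong to $L^1(\mathbb R)\cap L^2(\mathbb R)$, and $$\|g(X_{\Delta x})-g(X)\|_{L^1(\mathbb R)}\to0\quad\text{and}\quad\|g(X_{\Delta x})-g(X)\|_{L^2(\mathbb R)}\to0\qquad\text{as }\Delta x\downarrow0 .$$ -/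

import Mathlib

open MeasureTheory Set Filter Topology
open scoped ContDiff

namespace HunterSaxton

/-! ### Function spaces on the real line -/

/-- `f'` is the weak (distributional) derivative of `f` on `ℝ`. -/
def HasWeakDeriv (f f' : ℝ → ℝ) : Prop :=
  LocallyIntegrable f ∧ LocallyIntegrable f' ∧
    ∀ φ : ℝ → ℝ, ContDiff ℝ ∞ φ → HasCompactSupport φ →
      ∫ x, f x * deriv φ x = -∫ x, f' x * φ x

/-- The Sobolev space `H¹(ℝ)`; each class is represented by its continuous member. -/
def MemH1 (f : ℝ → ℝ) : Prop :=
  Continuous f ∧ MemLp f 2 ∧ ∃ f' : ℝ → ℝ, HasWeakDeriv f f' ∧ MemLp f' 2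

/-- A smooth partition of unity `χ⁺ + χ⁻ = 1` with `supp χ⁺ ⊆ (-1, ∞)` and
`supp χ⁻ ⊆ (-∞, 1)`. -/
structure IsPartitionPair (χp χm : ℝ → ℝ) : Prop where
  smooth_p : ContDiff ℝ ∞ χp
  smooth_m : ContDiff ℝ ∞ χm
  add_eq_one : ∀ x, χp x + χm x = 1
  mem_p : ∀ x, χp x ∈ Icc (0 : ℝ) 1
  mem_m : ∀ x, χm x ∈ Icc (0 : ℝ) 1
  tsupport_p : tsupport χp ⊆ Ioi (-1)
  tsupport_m : tsupport χm ⊆ Iio 1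

/-- The space `E₂ = {f̄ + a χ⁺ + b χ⁻ : f̄ ∈ H¹(ℝ), a, b ∈ ℝ}`; it does not depend on the
partition of unity. -/
def MemE2 (f : ℝ → ℝ) : Prop :=
  ∃ χp χm : ℝ → ℝ, IsPartitionPair χp χm ∧
    ∃ (fbar : ℝ → ℝ) (a b : ℝ), MemH1 fbar ∧ ∀ x, f x = fbar x + a * χp x + b * χm x

/-- The space `E₁⁰ = {f̄ + a χ⁺ : f̄ ∈ L²(ℝ), a ∈ ℝ}`; it does not depend on the
partition of unity. -/
def MemE10 (f : ℝ → ℝ) : Prop :=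
  ∃ χp χm : ℝ → ℝ, IsPartitionPair χp χm ∧
    ∃ (fbar : ℝ → ℝ) (a : ℝ), MemLp fbar 2 ∧ ∀ x, f x = fbar x + a * χp x

/-! ### Measures and their distribution functions -/

/-- The absolutely continuous part of `μ` with respect to Lebesgue measure. -/
noncomputable def acPart (μ : Measure ℝ) : Measure ℝ :=
  volume.withDensity (μ.rnDeriv volume)

/-- The left-continuous distribution function `x ↦ μ((-∞, x))`. -/
noncomputable def distFun (μ : Measure ℝ) (x : ℝ) : ℝ := μ.real (Iio x)

open Classical in
/-- The measure `m` with `m((-∞, x)) = F(x)`, for an increasing left-continuous bounded `F`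
that vanishes at `-∞` (see `measureOfDist_Iio`). -/
noncomputable def measureOfDist (F : ℝ → ℝ) : Measure ℝ :=
  if h : Monotone F then h.stieltjesFunction.measure else 0

/-- `measureOfDist F` has distribution function `F`. -/
theorem measureOfDist_Iio {F : ℝ → ℝ} (hF : Monotone F)
    (hleft : ∀ x, ContinuousWithinAt F (Iic x) x) (h0 : Tendsto F atBot (𝓝 0)) (x : ℝ) :
    measureOfDist F (Iio x) = ENNReal.ofReal (F x) := by
  have hle : ∀ y, F y ≤ hF.stieltjesFunction y := fun y => by
    rw [hF.stieltjesFunction_eq]; exact hF.le_rightLim le_rfl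
  have hge : ∀ y z, y < z → hF.stieltjesFunction y ≤ F z := fun y z hyz => by
    rw [hF.stieltjesFunction_eq]; exact hF.rightLim_le hyz
  have hbot : Tendsto hF.stieltjesFunction atBot (𝓝 0) :=
    tendsto_of_tendsto_of_tendsto_of_le_of_le h0
      (h0.comp (tendsto_atBot_add_const_right atBot 1 tendsto_id)) hle
      (fun y => hge y _ (by simp))
  have hL : Tendsto F (𝓝[<] x) (𝓝 (F x)) := (hleft x).mono Iio_subset_Iic_self
  have hlim : Function.leftLim hF.stieltjesFunction x = F x := by
    apply leftLim_eq_of_tendsto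
    refine tendsto_of_tendsto_of_tendsto_of_le_of_le' hL tendsto_const_nhds
      (Eventually.of_forall hle) ?_
    filter_upwards [self_mem_nhdsWithin] with y hy using hge y x hy
  rw [measureOfDist, dif_pos hF, StieltjesFunction.measure_Iio _ hbot, hlim, sub_zero]

/-! ### Eulerian coordinates -/

/-- A triplet `(u, μ, ν)`. -/
structure Eulerian where
  u : ℝ → ℝ
  μ : Measure ℝ
  ν : Measure ℝ

/-- The set `𝒟` of Eulerian coordinates for the parameter `α`; `ux` is the weak derivative
of `u`. -/
structure MemD (α : ℝ) (Z : Eulerian) : Prop where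
  u_mem : MemE2 Z.u
  finite_μ : IsFiniteMeasure Z.μ
  finite_ν : IsFiniteMeasure Z.ν
  μ_le_ν : Z.μ ≤ Z.ν
  ac_le_ac : acPart Z.μ ≤ acPart Z.ν
  F_mem : MemE10 (distFun Z.μ)
  G_mem : MemE10 (distFun Z.ν)
  energy : ∃ ux : ℝ → ℝ, HasWeakDeriv Z.u ux ∧
    acPart Z.μ = volume.withDensity (fun x => ENNReal.ofReal (ux x ^ 2)) ∧
    (α = 1 → acPart Z.ν = Z.μ ∧
      Z.μ = volume.withDensity (fun x => ENNReal.ofReal (ux x ^ 2))) ∧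
    (α < 1 →
      (∀ᵐ x ∂Z.ν, Z.μ.rnDeriv Z.ν x = ENNReal.ofReal (1 - α) ∨ Z.μ.rnDeriv Z.ν x = 1) ∧
      (∀ᵐ x ∂(acPart Z.ν), ux x < 0 → (acPart Z.μ).rnDeriv (acPart Z.ν) x = 1))

/-- The subset `𝒟₀ = {(u, μ, ν) ∈ 𝒟 : μ = ν}`. -/
def MemD0 (α : ℝ) (Z : Eulerian) : Prop := MemD α Z ∧ Z.μ = Z.ν

/-! ### The projection operator -/

/-- Grid points `x_i = i Δx`. -/
def grid (Δx : ℝ) (i : ℤ) : ℝ := i * Δx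

/-- The index `j` with `x_{2j} < x ≤ x_{2j+2}`. -/
noncomputable def cell (Δx x : ℝ) : ℤ := ⌈x / (2 * Δx)⌉ - 1

theorem mem_cell {Δx : ℝ} (h : 0 < Δx) (x : ℝ) :
    grid Δx (2 * cell Δx x) < x ∧ x ≤ grid Δx (2 * cell Δx x + 2) := by
  have h1 := Int.ceil_lt_add_one (x / (2 * Δx))
  have h2 := Int.le_ceil (x / (2 * Δx))
  have h3 : x / (2 * Δx) * (2 * Δx) = x := div_mul_cancel₀ _ (by positivity)
  constructor <;> simp only [grid, cell] <;> push_cast <;> nlinarith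

/-- The central difference `D f_{2j} = (f(x_{2j+2}) - f(x_{2j})) / (2 Δx)`. -/
noncomputable def centralDiff (Δx : ℝ) (f : ℝ → ℝ) (j : ℤ) : ℝ :=
  (f (grid Δx (2 * j + 2)) - f (grid Δx (2 * j))) / (2 * Δx)

/-- `q_{2j} = √(D F_{ac,2j} - (D u_{2j})²)`. -/
noncomputable def qCoef (Δx : ℝ) (Z : Eulerian) (j : ℤ) : ℝ :=
  Real.sqrt (centralDiff Δx (distFun (acPart Z.μ)) j - centralDiff Δx Z.u j ^ 2)

/-- The slope on `(x_{2j}, x_{2j+1}]`: the sign in front of `q_{2j}` is `(-1)^(k j)`. -/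
noncomputable def slopeLeft (Δx : ℝ) (k : ℤ → Fin 2) (Z : Eulerian) (j : ℤ) : ℝ :=
  centralDiff Δx Z.u j + (-1) ^ (k j : ℕ) * qCoef Δx Z j

/-- The slope on `(x_{2j+1}, x_{2j+2}]`: the opposite sign is used. -/
noncomputable def slopeRight (Δx : ℝ) (k : ℤ → Fin 2) (Z : Eulerian) (j : ℤ) : ℝ :=
  centralDiff Δx Z.u j - (-1) ^ (k j : ℕ) * qCoef Δx Z j

/-- The projected function `u_{Δx}`. -/
noncomputable def projU (Δx : ℝ) (k : ℤ → Fin 2) (Z : Eulerian) (x : ℝ) : ℝ :=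
  let j := cell Δx x
  if x ≤ grid Δx (2 * j + 1) then
    Z.u (grid Δx (2 * j)) + slopeLeft Δx k Z j * (x - grid Δx (2 * j))
  else
    Z.u (grid Δx (2 * j + 2)) + slopeRight Δx k Z j * (x - grid Δx (2 * j + 2))

/-- The absolutely continuous part `F_{Δx,ac}` of the projected distribution function. -/
noncomputable def projFac (Δx : ℝ) (k : ℤ → Fin 2) (Z : Eulerian) (x : ℝ) : ℝ :=
  let j := cell Δx x
  let Fac := distFun (acPart Z.μ)
  if x ≤ grid Δx (2 * j + 1) then
    Fac (grid Δx (2 * j)) + slopeLeft Δx k Z j ^ 2 * (x - grid Δx (2 * j))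
  else
    (Fac (grid Δx (2 * j + 2)) + Fac (grid Δx (2 * j))) / 2
      + (-1) ^ (k j : ℕ) * (2 * qCoef Δx Z j * centralDiff Δx Z.u j * Δx)
      + slopeRight Δx k Z j ^ 2 * (x - grid Δx (2 * j + 1))

/-- The singular part `F_{Δx,sing}` of the projected distribution function. -/
noncomputable def projFsing (Δx : ℝ) (Z : Eulerian) (x : ℝ) : ℝ :=
  let j := cell Δx x
  distFun Z.μ (grid Δx (2 * j + 2)) - distFun (acPart Z.μ) (grid Δx (2 * j + 2))

/-- The measure `μ_{Δx}` with `μ_{Δx}((-∞, x)) = F_{Δx,ac}(x) + F_{Δx,sing}(x)`. -/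
noncomputable def projMeasure (Δx : ℝ) (k : ℤ → Fin 2) (Z : Eulerian) : Measure ℝ :=
  measureOfDist (fun x => projFac Δx k Z x + projFsing Δx Z x)

/-- The projection operator `P_{Δx}` on `𝒟₀`, with sign choice `k`. -/
noncomputable def proj (Δx : ℝ) (k : ℤ → Fin 2) (Z : Eulerian) : Eulerian where
  u := projU Δx k Z
  μ := projMeasure Δx k Z
  ν := projMeasure Δx k Z

/-! ### Lagrangian coordinates -/

/-- A quadruplet `(y, U, V, H)`. -/
structure Lagrangian where
  y : ℝ → ℝ
  U : ℝ → ℝ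
  V : ℝ → ℝ
  H : ℝ → ℝ

/-- `y(ξ) = sup {x : ν((-∞, x)) + x < ξ}`. -/
noncomputable def charY (Z : Eulerian) (ξ : ℝ) : ℝ :=
  sSup {x : ℝ | distFun Z.ν x + x < ξ}

/-- `H(ξ) = ξ - y(ξ)`. -/
noncomputable def charH (Z : Eulerian) (ξ : ℝ) : ℝ := ξ - charY Z ξ

/-- The mapping `L` from Eulerian to Lagrangian coordinates. -/
noncomputable def toLagrangian (Z : Eulerian) : Lagrangian where
  y := charY Z
  U := fun ξ => Z.u (charY Z ξ)
  V := fun ξ => ∫ η in Iic ξ, (Z.μ.rnDeriv Z.ν (charY Z η)).toReal * deriv (charH Z) η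
  H := charH Z

open Classical in
/-- The stability function `g(X)`. The components of `X` are Lipschitz continuous, so that
their derivatives exist almost everywhere. -/
noncomputable def stability (α : ℝ) (X : Lagrangian) (ξ : ℝ) : ℝ :=
  if deriv X.U ξ < 0 then (1 - α) * deriv X.V ξ else deriv X.V ξ

end HunterSaxton

/-!
On `𝒟₀` the measures `μ` and `ν` agree, so that `V = H`, and `g(X) = (1 - α 1_{U_ξ < 0}) H_ξ`. The
proof rests on three observations.

*The derivatives take values in a circle.* With `F(x) = μ((-∞, x))`, the map `y` is the upper
adjoint of `x ↦ F(x) + x` (`le_charY_iff`), and it transports Lebesgue measure to `μ + dx`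
(`map_charY`). Almost everywhere either `y_ξ = 0`, or `y_ξ (1 + u_x²(y)) = 1` and
`U_ξ = u_x(y) y_ξ`. In both cases `H_ξ² + U_ξ² = H_ξ` (`IsRegular.exists_null_set`), which is the equation of a
circle. The grid values of `u` and `F` at `x_{2j}` are not changed by the projection, hence
`y_{Δx} → y` and `U_{Δx} → U` uniformly. This gives weak convergence of `(H_ξ, U_ξ)` in `L²`;
since `|w_{Δx} - w|² = (H_{Δx,ξ} - H_ξ) - 2 w · (w_{Δx} - w)` for `w = (H_ξ, U_ξ)`, and the total
energy is preserved, the convergence is strong (`tendsto_integral_sq_sub`).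

*Concentrated energy stays concentrated.* As a function on the circle, `g` is continuous except at
the point `(1, 0)`, which is attained where `y` runs into the set `N` carrying the concentrated
energy. The projection moves the singular energy of a cell to its left end point. The null set `N`
is approximated from inside by a compact set, and this one from outside by an open set of small
Lebesgue measure and small absolutely continuous energy. So all but a small part of the
characteristics that end up in `N` end up in grid points after the projection
(`MemD0.tendsto_volume_sdiff`), and there `g(X) = g(X_{Δx}) = 1`.

*Domination.* Along a subsequence of any sequence of mesh sizes, `g(X_{Δx}) → g(X)` almost
everywhere (`MemD0.exists_subseq_ae_tendsto`). From `|g(X_{Δx}) - g(X)| ≤ H_{Δx,ξ} + H_ξ`, where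
the two terms on the right have the same integral, convergence in `L¹` follows
(`tendsto_integral_abs_sub`). Convergence in `L²` is then a consequence of
`|g(X_{Δx}) - g(X)| ≤ 1`.

All this applies to the projected triplets because they share the relevant properties of elements
of `𝒟₀`, collected in `IsRegular` (`MemD0.isRegular`, `MemD0.isRegular_proj`).
-/

namespace HunterSaxton

/-! ### Distribution functions of finite measures -/

theorem tendsto_atBot_of_comp {ι : Type*} {F : ℝ → ℝ} {φ : ι → ℝ} {l : Filter ι} [l.NeBot] {c : ℝ}
    (hF : Monotone F) (h0 : ∀ x, 0 ≤ F x) (hφ : Tendsto φ l atBot)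
    (h : Tendsto (fun i => F (φ i)) l (𝓝 c)) : Tendsto F atBot (𝓝 c) := by
  have h1 := tendsto_atBot_ciInf hF ⟨0, by rintro _ ⟨x, rfl⟩; exact h0 x⟩
  rwa [tendsto_nhds_unique (h1.comp hφ) h] at h1

section DistFun

variable {ν : Measure ℝ} [IsFiniteMeasure ν]

theorem ofReal_distFun (x : ℝ) : ENNReal.ofReal (distFun ν x) = ν (Iio x) :=
  ofReal_measureReal

theorem distFun_mono (ν : Measure ℝ) [IsFiniteMeasure ν] : Monotone (distFun ν) :=
  fun _ _ h => measureReal_mono (Iio_subset_Iio h)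

theorem distFun_nonneg (ν : Measure ℝ) (x : ℝ) : 0 ≤ distFun ν x := measureReal_nonneg

theorem distFun_le (ν : Measure ℝ) [IsFiniteMeasure ν] (x : ℝ) : distFun ν x ≤ ν.real univ :=
  measureReal_mono (subset_univ _)

theorem measure_Ico_eq_distFun {a b : ℝ} (hab : a ≤ b) :
    ν (Ico a b) = ENNReal.ofReal (distFun ν b - distFun ν a) := by
  rw [← Iio_sdiff_Iio, measure_sdiff (Iio_subset_Iio hab) nullMeasurableSet_Iio
    (measure_ne_top _ _), ← ofReal_distFun, ← ofReal_distFun,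
    ENNReal.ofReal_sub _ (distFun_nonneg _ _)]

theorem tendsto_distFun_atTop : Tendsto (distFun ν) atTop (𝓝 (ν.real univ)) := by
  have h : Tendsto (fun n : ℕ => distFun ν n) atTop (𝓝 (ν.real univ)) := by
    have hU : (⋃ n : ℕ, Iio (n : ℝ)) = univ :=
      iUnion_eq_univ_iff.2 fun x => exists_nat_gt x
    have := tendsto_measure_iUnion_atTop (μ := ν) (s := fun n : ℕ => Iio (n : ℝ))
      (fun m n h => Iio_subset_Iio (by exact_mod_cast h))
    rw [hU] at this
    exact (ENNReal.tendsto_toReal (measure_ne_top _ _)).comp this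
  exact (tendsto_iff_tendsto_subseq_of_monotone (distFun_mono ν)
    tendsto_natCast_atTop_atTop).2 h

theorem tendsto_distFun_atBot : Tendsto (distFun ν) atBot (𝓝 0) := by
  have h : Tendsto (fun n : ℕ => distFun ν (-n)) atTop (𝓝 0) := by
    have hU : (⋂ n : ℕ, Iio (-(n : ℝ))) = ∅ := by
      refine eq_empty_of_forall_notMem fun x hx => ?_
      obtain ⟨n, hn⟩ := exists_nat_gt (-x)
      have := mem_iInter.1 hx n
      simp only [mem_Iio] at this
      linarith
    have := tendsto_measure_iInter_atTop (μ := ν) (s := fun n : ℕ => Iio (-(n : ℝ)))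
      (fun n => nullMeasurableSet_Iio)
      (fun m n h => Iio_subset_Iio (by simpa using h)) ⟨0, measure_ne_top _ _⟩
    rw [hU, measure_empty] at this
    exact (ENNReal.tendsto_toReal ENNReal.zero_ne_top).comp this
  exact tendsto_atBot_of_comp (distFun_mono ν) (distFun_nonneg ν)
    (tendsto_neg_atTop_atBot.comp tendsto_natCast_atTop_atTop) h

theorem tendsto_distFun_nhdsLT (x : ℝ) : Tendsto (distFun ν) (𝓝[<] x) (𝓝 (distFun ν x)) := by
  obtain ⟨v, hv, hvx, hvl⟩ := exists_seq_strictMono_tendsto x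
  have hU : (⋃ n : ℕ, Iio (v n)) = Iio x := by
    ext z
    simp only [mem_iUnion, mem_Iio]
    exact ⟨fun ⟨n, hn⟩ => hn.trans (hvx n), fun hz => (hvl.eventually_const_lt hz).exists⟩
  have h1 := tendsto_measure_iUnion_atTop (μ := ν) (s := fun n : ℕ => Iio (v n))
      (fun m n h => Iio_subset_Iio (hv.monotone h))
  rw [hU] at h1
  have h2 : Tendsto (fun n => distFun ν (v n)) atTop (𝓝 (distFun ν x)) :=
    (ENNReal.tendsto_toReal (measure_ne_top _ _)).comp h1
  have h3 := (distFun_mono ν).tendsto_nhdsLT x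
  have h4 : Tendsto v atTop (𝓝[<] x) :=
    tendsto_nhdsWithin_iff.2 ⟨hvl, Eventually.of_forall hvx⟩
  rwa [tendsto_nhds_unique (h3.comp h4) h2] at h3

theorem distFun_leftCont (x : ℝ) : ContinuousWithinAt (distFun ν) (Iic x) x := by
  rw [← continuousWithinAt_Iio_iff_Iic]
  exact tendsto_distFun_nhdsLT x

/-- A finite measure is recovered from its distribution function. -/
theorem measureOfDist_distFun (ν : Measure ℝ) [IsFiniteMeasure ν] :
    measureOfDist (distFun ν) = ν := by
  have h := measureOfDist_Iio (distFun_mono ν) distFun_leftCont tendsto_distFun_atBot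
  symm
  refine Measure.ext_of_Ico _ _ fun a b hab => ?_
  rw [measure_Ico_eq_distFun hab.le, ← Iio_sdiff_Iio, measure_sdiff (Iio_subset_Iio hab.le)
    nullMeasurableSet_Iio (by simp [h]), h, h, ENNReal.ofReal_sub _ (distFun_nonneg _ _)]

/-- Lebesgue's differentiation theorem for distribution functions. -/
theorem ae_hasDerivAt_distFun (ν : Measure ℝ) [IsFiniteMeasure ν] :
    ∀ᵐ x, HasDerivAt (distFun ν) (ν.rnDeriv volume x).toReal x := by
  have h := (distFun_mono ν).ae_hasDerivAt
  have h' := measureOfDist_distFun ν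
  rw [measureOfDist, dif_pos (distFun_mono ν)] at h'
  rwa [h'] at h

end DistFun

/-! ### The characteristics -/

section Characteristics

theorem bddAbove_charY (Z : Eulerian) (ξ : ℝ) : BddAbove {x : ℝ | distFun Z.ν x + x < ξ} :=
  ⟨ξ, fun x (hx : _ < ξ) => by linarith [distFun_nonneg Z.ν x]⟩

variable {Z : Eulerian} [IsFiniteMeasure Z.ν]

theorem nonempty_charY (ξ : ℝ) : {x : ℝ | distFun Z.ν x + x < ξ}.Nonempty :=
  ⟨ξ - Z.ν.real univ - 1, by
    simp only [mem_ofPred_eq]; linarith [distFun_le Z.ν (ξ - Z.ν.real univ - 1)]⟩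

/-- The characteristic `y` is the upper adjoint of `x ↦ ν((-∞, x)) + x`. All elementary
properties of `y` follow from this. -/
theorem le_charY_iff {a ξ : ℝ} : a ≤ charY Z ξ ↔ distFun Z.ν a + a ≤ ξ := by
  constructor
  · intro h
    have h1 : ∀ x < a, distFun Z.ν x + x ≤ ξ := fun x hx => by
      obtain ⟨z, hz, hxz⟩ := exists_lt_of_lt_csSup (nonempty_charY ξ) (hx.trans_le h)
      have := distFun_mono Z.ν hxz.le
      simp only [mem_ofPred_eq] at hz
      linarith
    have h2 : Tendsto (fun x => distFun Z.ν x + x) (𝓝[<] a) (𝓝 (distFun Z.ν a + a)) :=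
      (tendsto_distFun_nhdsLT a).add (tendsto_id.mono_left nhdsWithin_le_nhds)
    exact le_of_tendsto h2 (eventually_nhdsWithin_of_forall h1)
  · intro h
    refine le_of_forall_lt fun x hx => ?_
    refine (by linarith : x < (x + a) / 2).trans_le (le_csSup (bddAbove_charY Z ξ) ?_)
    have := distFun_mono Z.ν (by linarith : (x + a) / 2 ≤ a)
    simp only [mem_ofPred_eq]
    linarith

theorem charY_lt_iff {a ξ : ℝ} : charY Z ξ < a ↔ ξ < distFun Z.ν a + a := by
  rw [← not_le, le_charY_iff, not_le]

theorem charY_apply (x : ℝ) : charY Z (distFun Z.ν x + x) = x := by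
  refine le_antisymm (le_of_forall_gt fun z hz => ?_) (le_charY_iff.2 le_rfl)
  exact charY_lt_iff.2 (by linarith [distFun_mono Z.ν hz.le])

theorem distFun_charY_le (ξ : ℝ) : distFun Z.ν (charY Z ξ) + charY Z ξ ≤ ξ :=
  le_charY_iff.1 le_rfl

theorem charY_mono (Z : Eulerian) [IsFiniteMeasure Z.ν] : Monotone (charY Z) := fun _ _ h =>
  le_charY_iff.2 ((distFun_charY_le _).trans h)

theorem charY_sub_le {a b : ℝ} (hab : a ≤ b) : charY Z b - charY Z a ≤ b - a := by
  have h : charY Z b - (b - a) ≤ charY Z a := by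
    rw [le_charY_iff]
    have h1 := distFun_charY_le (Z := Z) b
    have h2 := distFun_mono Z.ν (by linarith : charY Z b - (b - a) ≤ charY Z b)
    linarith
  linarith

theorem charH_mono (Z : Eulerian) [IsFiniteMeasure Z.ν] : Monotone (charH Z) := fun a b h => by
  have := charY_sub_le (Z := Z) h
  simp only [charH]; linarith

theorem charY_lipschitz (Z : Eulerian) [IsFiniteMeasure Z.ν] : LipschitzWith 1 (charY Z) := by
  refine LipschitzWith.of_le_add fun a b => ?_
  rcases le_total a b with h | h
  · linarith [charY_mono Z h, dist_nonneg (x := a) (y := b)]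
  · have := charY_sub_le (Z := Z) h
    rw [Real.dist_eq]; linarith [le_abs_self (a - b)]

theorem charH_lipschitz (Z : Eulerian) [IsFiniteMeasure Z.ν] : LipschitzWith 1 (charH Z) := by
  refine LipschitzWith.of_le_add fun a b => ?_
  rcases le_total a b with h | h
  · linarith [charH_mono Z h, dist_nonneg (x := a) (y := b)]
  · have := charY_mono Z h
    rw [Real.dist_eq]; simp only [charH]; linarith [le_abs_self (a - b)]

theorem charH_nonneg (ξ : ℝ) : 0 ≤ charH Z ξ := by
  have := distFun_charY_le (Z := Z) ξ
  have := distFun_nonneg Z.ν (charY Z ξ)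
  simp only [charH]; linarith

theorem charH_le (ξ : ℝ) : charH Z ξ ≤ Z.ν.real univ := by
  have : ξ - Z.ν.real univ ≤ charY Z ξ := by
    rw [le_charY_iff]; linarith [distFun_le Z.ν (ξ - Z.ν.real univ)]
  simp only [charH]; linarith

theorem charH_apply (x : ℝ) : charH Z (distFun Z.ν x + x) = distFun Z.ν x := by
  rw [charH, charY_apply]; ring

theorem tendsto_charH_atTop : Tendsto (charH Z) atTop (𝓝 (Z.ν.real univ)) := by
  have h : Tendsto (fun x : ℝ => distFun Z.ν x + x) atTop atTop :=
    tendsto_atTop_mono (fun x => by simp only [id]; linarith [distFun_nonneg Z.ν x]) tendsto_id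
  refine (tendsto_iff_tendsto_subseq_of_monotone (charH_mono Z) h).2 ?_
  simpa only [Function.comp_def, charH_apply] using tendsto_distFun_atTop

theorem tendsto_charH_atBot : Tendsto (charH Z) atBot (𝓝 0) := by
  have h : Tendsto (fun x : ℝ => distFun Z.ν x + x) atBot atBot :=
    tendsto_atBot_mono (fun x => by
      show _ ≤ Z.ν.real univ + x
      linarith [distFun_le Z.ν x]) (tendsto_atBot_add_const_left _ _ tendsto_id)
  refine tendsto_atBot_of_comp (charH_mono Z) charH_nonneg h ?_
  simpa only [charH_apply] using tendsto_distFun_atBot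

/-- Lebesgue measure on the Lagrangian line is transported by `y` to `ν` plus Lebesgue measure. -/
theorem map_charY (Z : Eulerian) [IsFiniteMeasure Z.ν] :
    Measure.map (charY Z) volume = Z.ν + volume := by
  symm
  refine Measure.ext_of_Ico' _ _ (fun a b _ =>
    ENNReal.add_ne_top.2 ⟨measure_ne_top _ _, measure_Ico_lt_top.ne⟩) fun a b hab => ?_
  have h : charY Z ⁻¹' Ico a b = Ico (distFun Z.ν a + a) (distFun Z.ν b + b) := by
    ext ξ; simp only [mem_preimage, mem_Ico, le_charY_iff, charY_lt_iff]
  rw [Measure.map_apply (charY_lipschitz Z).continuous.measurable measurableSet_Ico, h,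
    Measure.add_apply, measure_Ico_eq_distFun hab.le, Real.volume_Ico, Real.volume_Ico,
    ← ENNReal.ofReal_add (by linarith [distFun_mono Z.ν hab.le]) (by linarith)]
  congr 1; ring

theorem volume_preimage_charY {s : Set ℝ} (hs : MeasurableSet s) :
    volume (charY Z ⁻¹' s) = Z.ν s + volume s := by
  rw [← Measure.map_apply (charY_lipschitz Z).continuous.measurable hs, map_charY,
    Measure.add_apply]

theorem ae_hasDerivAt_charY (Z : Eulerian) [IsFiniteMeasure Z.ν] :
    ∀ᵐ ξ, HasDerivAt (charY Z) (deriv (charY Z) ξ) ξ := by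
  filter_upwards [(charY_lipschitz Z).ae_differentiableAt_real] with ξ h using h.hasDerivAt

theorem ae_deriv_charH (Z : Eulerian) [IsFiniteMeasure Z.ν] :
    ∀ᵐ ξ, HasDerivAt (charH Z) (deriv (charH Z) ξ) ξ ∧
      deriv (charH Z) ξ = 1 - deriv (charY Z) ξ := by
  filter_upwards [ae_hasDerivAt_charY Z] with ξ h
  have h' : HasDerivAt (charH Z) (1 - deriv (charY Z) ξ) ξ := (hasDerivAt_id ξ).sub h
  exact ⟨h'.differentiableAt.hasDerivAt, h'.deriv⟩

theorem deriv_charY_nonneg (ξ : ℝ) : 0 ≤ deriv (charY Z) ξ := (charY_mono Z).deriv_nonneg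

theorem deriv_charH_nonneg (ξ : ℝ) : 0 ≤ deriv (charH Z) ξ := (charH_mono Z).deriv_nonneg

theorem deriv_charH_le_one (ξ : ℝ) : deriv (charH Z) ξ ≤ 1 := by
  have := norm_deriv_le_of_lipschitz (charH_lipschitz Z) (x₀ := ξ)
  exact (le_abs_self _).trans (by simpa using this)

/-- Characteristics that end up in a Lebesgue null set have been concentrated: `y_ξ = 0`. -/
theorem ae_deriv_charY_eq_zero {N : Set ℝ} (hN : volume N = 0) :
    ∀ᵐ ξ, charY Z ξ ∈ N → deriv (charY Z) ξ = 0 := by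
  obtain ⟨N', hNN', hN'm, hN'⟩ := exists_measurable_superset_of_null hN
  set D : Set ℝ := {ξ | DifferentiableAt ℝ (charY Z) ξ}
  set s : Set ℝ := charY Z ⁻¹' N' ∩ D
  have hs : MeasurableSet s :=
    ((charY_lipschitz Z).continuous.measurable hN'm).inter (measurableSet_of_differentiableAt ℝ _)
  have h1 := lintegral_deriv_eq_volume_image_of_monotoneOn hs (f := charY Z)
    (f' := deriv (charY Z)) (fun x hx => hx.2.hasDerivAt.hasDerivWithinAt)
    ((charY_mono Z).monotoneOn s)
  have h2 : volume (charY Z '' s) = 0 :=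
    measure_mono_null (by rintro _ ⟨x, hx, rfl⟩; exact hx.1) hN'
  rw [h2, lintegral_eq_zero_iff (measurable_deriv _).ennreal_ofReal, EventuallyEq,
    ae_restrict_iff' hs] at h1
  filter_upwards [h1, (charY_lipschitz Z).ae_differentiableAt_real] with ξ hξ hd hy
  have := hξ ⟨hNN' hy, hd⟩
  simp only [Pi.zero_apply, ENNReal.ofReal_eq_zero] at this
  exact le_antisymm this (deriv_charY_nonneg ξ)

/-- At a point where the distribution function is differentiable, the slope of `y` is the
inverse of the slope of `x ↦ F(x) + x`. -/
theorem deriv_charY_mul {ξ f : ℝ} (hF : HasDerivAt (distFun Z.ν) f (charY Z ξ))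
    (hy : HasDerivAt (charY Z) (deriv (charY Z) ξ) ξ) : deriv (charY Z) ξ * (1 + f) = 1 := by
  have hG : HasDerivAt (fun x => distFun Z.ν x + x) (f + 1) (charY Z ξ) :=
    hF.add (hasDerivAt_id _)
  have hξ : distFun Z.ν (charY Z ξ) + charY Z ξ = ξ := by
    refine le_antisymm (distFun_charY_le ξ) ?_
    refine ge_of_tendsto (b := ξ) (x := 𝓝[>] (charY Z ξ))
      (hG.continuousAt.mono_left nhdsWithin_le_nhds) ?_
    filter_upwards [self_mem_nhdsWithin] with x hx
    exact (charY_lt_iff.1 hx).le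
  have h1 : HasDerivAt (fun x => charY Z (distFun Z.ν x + x)) (deriv (charY Z) ξ * (f + 1))
      (charY Z ξ) := HasDerivAt.comp _ (h₂ := charY Z) (by rwa [hξ]) hG
  have h2 : HasDerivAt (fun x => charY Z (distFun Z.ν x + x)) 1 (charY Z ξ) := by
    simp only [charY_apply]; exact hasDerivAt_id _
  rw [add_comm 1 f, h1.unique h2]

/-- The measure with density `H_ξ` is transported by `y` into a measure that is absolutely
continuous with respect to `ν`. -/
theorem ae_deriv_charH_eq_zero {N : Set ℝ} (hN : Z.ν N = 0) :
    ∀ᵐ ξ, charY Z ξ ∈ N → deriv (charH Z) ξ = 0 := by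
  obtain ⟨N₁, hNN₁, hN₁m, hN₁⟩ := exists_measurable_superset_of_null hN
  -- Almost everywhere on a `ν`-null set the distribution function has derivative zero.
  have h1 : ∀ᵐ x, x ∈ N₁ → HasDerivAt (distFun Z.ν) 0 x := by
    have h0 : ∫⁻ x in N₁, Z.ν.rnDeriv volume x = 0 :=
      le_antisymm ((Measure.setLIntegral_rnDeriv_le N₁).trans hN₁.le) zero_le
    rw [lintegral_eq_zero_iff (Measure.measurable_rnDeriv _ _), EventuallyEq,
      ae_restrict_iff' hN₁m] at h0
    filter_upwards [h0, ae_hasDerivAt_distFun Z.ν] with x hx hd hm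
    simpa [hx hm] using hd
  obtain ⟨N₂, hN₂s, hN₂m, hN₂⟩ := exists_measurable_superset_of_null (ae_iff.1 h1)
  have h3 : volume (charY Z ⁻¹' (N₁ ∩ N₂)) = 0 := by
    rw [volume_preimage_charY (hN₁m.inter hN₂m), measure_mono_null inter_subset_left hN₁,
      measure_mono_null inter_subset_right hN₂, add_zero]
  filter_upwards [measure_eq_zero_iff_ae_notMem.1 h3, ae_hasDerivAt_charY Z, ae_deriv_charH Z]
    with ξ h4 hy hH hξ
  have h5 : charY Z ξ ∉ N₂ := fun h => h4 ⟨hNN₁ hξ, h⟩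
  have h6 : HasDerivAt (distFun Z.ν) 0 (charY Z ξ) := by
    by_contra hcon
    exact h5 (hN₂s fun h => hcon (h (hNN₁ hξ)))
  have := deriv_charY_mul h6 hy
  rw [hH.2]; linarith

end Characteristics

/-! ### Regular Eulerian triplets -/

/-- The properties of elements of `𝒟₀` on which the argument rests. They are shared by the
projected triplets, and involve `μ = ν` only through its distribution function `F`: the
Cauchy–Schwarz bound for `u`, and `F' = u'²` almost everywhere. -/
structure IsRegular (Z : Eulerian) : Prop where
  finite : IsFiniteMeasure Z.ν
  μ_eq : Z.μ = Z.ν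
  sq_sub_le : ∀ a b, a ≤ b → (Z.u b - Z.u a) ^ 2 ≤ (b - a) * (distFun Z.ν b - distFun Z.ν a)
  ae_hasDerivAt : ∀ᵐ x, ∃ p, HasDerivAt Z.u p x ∧ HasDerivAt (distFun Z.ν) (p ^ 2) x

/-- The Lagrangian velocity `U = u ∘ y`. -/
noncomputable def charU (Z : Eulerian) (ξ : ℝ) : ℝ := Z.u (charY Z ξ)

namespace IsRegular

variable {Z : Eulerian}

theorem abs_sub_le (hZ : IsRegular Z) (a b : ℝ) :
    |Z.u b - Z.u a| ≤ √(|b - a| * Z.ν.real univ) := by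
  have := hZ.finite
  wlog h : a ≤ b generalizing a b
  · rw [abs_sub_comm, abs_sub_comm b]; exact this b a (le_of_not_ge h)
  refine Real.abs_le_sqrt ((hZ.sq_sub_le a b h).trans ?_)
  rw [abs_of_nonneg (sub_nonneg.2 h)]
  have h1 := distFun_le Z.ν b
  have h2 := distFun_nonneg Z.ν a
  exact mul_le_mul_of_nonneg_left (by linarith) (sub_nonneg.2 h)

theorem continuous_u (hZ : IsRegular Z) : Continuous Z.u := by
  refine continuous_iff_continuousAt.2 fun a => ?_
  rw [ContinuousAt, tendsto_iff_norm_sub_tendsto_zero]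
  refine squeeze_zero (fun _ => norm_nonneg _) (fun x => hZ.abs_sub_le a x) ?_
  have : Continuous fun x => √(|x - a| * Z.ν.real univ) := by fun_prop
  simpa using this.tendsto a

/-- Differences of `U` are controlled by those of `y` and `H`. -/
theorem sq_charU_sub_le (hZ : IsRegular Z) {a b : ℝ} (hab : a ≤ b) :
    (charU Z b - charU Z a) ^ 2 ≤
      (charY Z b - charY Z a) * ((b - a) - (charY Z b - charY Z a)) := by
  have := hZ.finite
  rcases (charY_mono Z hab).eq_or_lt with h | h
  · simp [charU, h]
  -- The bound for `u` is used on `[x, y b]` with `x ↓ y a`, since the atom of `ν` at `y a` may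
  -- belong to the characteristics on the left of `a`.
  have h1 : ∀ x ∈ Ioc (charY Z a) (charY Z b), (Z.u (charY Z b) - Z.u x) ^ 2 ≤
      (charY Z b - x) * ((b - a) - (charY Z b - x)) := fun x hx => by
    refine (hZ.sq_sub_le x _ hx.2).trans (mul_le_mul_of_nonneg_left ?_ (by linarith [hx.2]))
    have h2 := distFun_charY_le (Z := Z) b
    have h3 := charY_lt_iff.1 hx.1
    linarith
  have hc := hZ.continuous_u
  have h4 : Continuous fun x => (Z.u (charY Z b) - Z.u x) ^ 2 := by fun_prop
  have h5 : Continuous fun x => (charY Z b - x) * ((b - a) - (charY Z b - x)) := by fun_prop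
  refine le_of_tendsto_of_tendsto (b := 𝓝[>] (charY Z a))
    ((h4.tendsto _).mono_left nhdsWithin_le_nhds) ((h5.tendsto _).mono_left nhdsWithin_le_nhds) ?_
  filter_upwards [Ioc_mem_nhdsGT h] with x hx using h1 x hx

theorem charU_lipschitz (hZ : IsRegular Z) : LipschitzWith 1 (charU Z) := by
  have := hZ.finite
  refine LipschitzWith.of_dist_le_mul fun a b => ?_
  wlog h : a ≤ b generalizing a b
  · rw [dist_comm, dist_comm a]; exact this b a (le_of_not_ge h)
  rw [dist_comm, dist_comm a, Real.dist_eq, Real.dist_eq, abs_of_nonneg (sub_nonneg.2 h)]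
  simp only [NNReal.coe_one, one_mul]
  refine abs_le_of_sq_le_sq ((hZ.sq_charU_sub_le h).trans ?_) (sub_nonneg.2 h)
  nlinarith [charY_mono Z h, charY_sub_le (Z := Z) h]

theorem ae_hasDerivAt_charU (hZ : IsRegular Z) :
    ∀ᵐ ξ, HasDerivAt (charU Z) (deriv (charU Z) ξ) ξ := by
  filter_upwards [hZ.charU_lipschitz.ae_differentiableAt_real] with ξ h using h.hasDerivAt

theorem sq_deriv_charU_le (hZ : IsRegular Z) {ξ : ℝ}
    (hU : HasDerivAt (charU Z) (deriv (charU Z) ξ) ξ)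
    (hy : HasDerivAt (charY Z) (deriv (charY Z) ξ) ξ) :
    deriv (charU Z) ξ ^ 2 ≤ deriv (charY Z) ξ * (1 - deriv (charY Z) ξ) := by
  have h1 := hU.tendsto_slope.mono_left (nhdsWithin_mono ξ fun x (hx : ξ < x) => hx.ne')
  have h2 := hy.tendsto_slope.mono_left (nhdsWithin_mono ξ fun x (hx : ξ < x) => hx.ne')
  refine le_of_tendsto_of_tendsto (b := 𝓝[>] ξ) (h1.pow 2) (h2.mul (h2.const_sub 1)) ?_
  filter_upwards [self_mem_nhdsWithin] with x hx
  have hx' : 0 < x - ξ := sub_pos.2 hx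
  rw [slope_def_field, slope_def_field, div_pow, one_sub_div hx'.ne', div_mul_div_comm, ← sq,
    div_le_div_iff_of_pos_right (by positivity)]
  exact hZ.sq_charU_sub_le (le_of_lt hx)

/-- There is a Lebesgue null set `N` such that `y⁻¹(N)` is, up to a null set, the set where
`H_ξ = 1`, that is, `y_ξ = 0`. Moreover `(H_ξ, U_ξ)` takes values in the circle
that has the segment from `(0, 0)` to `(1, 0)` as a diameter. -/
theorem exists_null_set (hZ : IsRegular Z) : ∃ N : Set ℝ, MeasurableSet N ∧ volume N = 0 ∧
    ∀ᵐ ξ, (charY Z ξ ∈ N → deriv (charH Z) ξ = 1) ∧ (charY Z ξ ∉ N → deriv (charH Z) ξ ≠ 1) ∧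
      deriv (charH Z) ξ ^ 2 + deriv (charU Z) ξ ^ 2 = deriv (charH Z) ξ := by
  have := hZ.finite
  obtain ⟨N, hNs, hNm, hN⟩ := exists_measurable_superset_of_null (ae_iff.1 hZ.ae_hasDerivAt)
  refine ⟨N, hNm, hN, ?_⟩
  filter_upwards [ae_deriv_charY_eq_zero (Z := Z) hN, ae_hasDerivAt_charY Z, ae_deriv_charH Z,
    hZ.ae_hasDerivAt_charU] with ξ h0 hy hH hU
  rw [hH.2]
  by_cases hξ : charY Z ξ ∈ N
  · have h1 := h0 hξ
    have h2 := hZ.sq_deriv_charU_le hU hy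
    simp only [h1, zero_mul, sub_zero, hξ, not_true_eq_false, false_imp_iff, true_and,
      one_pow] at h2 ⊢
    exact ⟨fun _ => trivial, by nlinarith [sq_nonneg (deriv (charU Z) ξ)]⟩
  · obtain ⟨p, hp, hF⟩ : ∃ p, HasDerivAt Z.u p (charY Z ξ) ∧
        HasDerivAt (distFun Z.ν) (p ^ 2) (charY Z ξ) := by
      by_contra hcon
      exact hξ (hNs hcon)
    have h1 := deriv_charY_mul hF hy
    have h2 : deriv (charU Z) ξ = p * deriv (charY Z) ξ := (hp.comp ξ hy).deriv
    refine ⟨fun h => absurd h hξ, fun _ h => ?_, ?_⟩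
    · have : deriv (charY Z) ξ = 0 := by linarith
      rw [this] at h1; simp at h1
    · rw [h2]; linear_combination deriv (charY Z) ξ * h1

/-- The length of `(H_ξ, U_ξ)` is determined by `H_ξ`. -/
theorem ae_circle (hZ : IsRegular Z) :
    ∀ᵐ ξ, deriv (charH Z) ξ ^ 2 + deriv (charU Z) ξ ^ 2 = deriv (charH Z) ξ := by
  obtain ⟨N, -, -, h⟩ := hZ.exists_null_set
  filter_upwards [h] with ξ hξ using hξ.2.2

end IsRegular

/-! ### The energy variable -/

section Energy

theorem intervalIntegral_deriv_charH (Z : Eulerian) [IsFiniteMeasure Z.ν] (a b : ℝ) :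
    IntervalIntegrable (deriv (charH Z)) volume a b ∧
      ∫ ξ in a..b, deriv (charH Z) ξ = charH Z b - charH Z a := by
  have := (charH_lipschitz Z).lipschitzOnWith (s := uIcc a b) |>.absolutelyContinuousOnInterval
  exact ⟨this.intervalIntegrable_deriv, this.integral_deriv_eq_sub⟩

theorem integrable_deriv_charH (Z : Eulerian) [IsFiniteMeasure Z.ν] :
    Integrable (deriv (charH Z)) := by
  refine integrable_of_intervalIntegral_norm_bounded (l := atTop) (a := fun x : ℝ => -x)
    (b := fun x => x) (Z.ν.real univ) (fun x => ?_) tendsto_neg_atTop_atBot tendsto_id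
    (Eventually.of_forall fun x => ?_)
  · exact (intervalIntegral_deriv_charH Z _ _).1.1
  · simp only [Real.norm_of_nonneg (deriv_charH_nonneg _)]
    rw [(intervalIntegral_deriv_charH Z _ _).2]
    linarith [charH_le (Z := Z) x, charH_nonneg (Z := Z) (-x)]

theorem integral_Iic_deriv_charH (Z : Eulerian) [IsFiniteMeasure Z.ν] (ξ : ℝ) :
    ∫ η in Iic ξ, deriv (charH Z) η = charH Z ξ := by
  refine tendsto_nhds_unique (intervalIntegral_tendsto_integral_Iic ξ
    (integrable_deriv_charH Z).integrableOn tendsto_id) ?_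
  simp only [(intervalIntegral_deriv_charH Z _ _).2, id]
  simpa using tendsto_charH_atBot.const_sub (charH Z ξ)

theorem integral_deriv_charH (Z : Eulerian) [IsFiniteMeasure Z.ν] :
    ∫ ξ, deriv (charH Z) ξ = Z.ν.real univ := by
  refine tendsto_nhds_unique (intervalIntegral_tendsto_integral (integrable_deriv_charH Z)
    tendsto_neg_atTop_atBot tendsto_id) ?_
  simp only [(intervalIntegral_deriv_charH Z _ _).2, id]
  simpa using tendsto_charH_atTop.sub (tendsto_charH_atBot.comp tendsto_neg_atTop_atBot)

/-- On `𝒟₀` the variables `V` and `H` coincide, because `dμ/dμ = 1` `μ`-almost everywhere and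
`H_ξ dξ` is transported into `μ`. -/
theorem toLagrangian_V {Z : Eulerian} (hZ : IsRegular Z) : (toLagrangian Z).V = charH Z := by
  have := hZ.finite
  ext ξ
  rw [← integral_Iic_deriv_charH Z ξ, toLagrangian]
  refine integral_congr_ae (ae_restrict_of_ae ?_)
  have h := Measure.rnDeriv_self Z.ν
  filter_upwards [ae_deriv_charH_eq_zero (ae_iff.1 h)] with η hη
  by_cases h1 : Z.ν.rnDeriv Z.ν (charY Z η) = 1
  · rw [hZ.μ_eq, h1, ENNReal.toReal_one, one_mul]
  · rw [hη h1, mul_zero]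

end Energy

/-- For regular triplets, `g(X) = (1 - α 1_{U_ξ < 0}) H_ξ`. -/
theorem stability_eq {Z : Eulerian} (hZ : IsRegular Z) (α ξ : ℝ) :
    stability α (toLagrangian Z) ξ =
      if deriv (charU Z) ξ < 0 then (1 - α) * deriv (charH Z) ξ else deriv (charH Z) ξ := by
  rw [stability, toLagrangian_V hZ]; rfl

theorem eLpNorm_two_sq_le {f : ℝ → ℝ} (h : ∀ x, |f x| ≤ 1) :
    eLpNorm f 2 volume ^ 2 ≤ eLpNorm f 1 volume := by
  have h2 : eLpNorm f 2 volume ^ 2 = ∫⁻ x, ‖f x‖ₑ ^ 2 := by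
    have h1 := eLpNorm_nnreal_pow_eq_lintegral (f := f) (μ := volume) (p := 2) two_ne_zero
    simp only [ENNReal.coe_ofNat, NNReal.coe_ofNat, ENNReal.rpow_ofNat] at h1
    exact h1
  rw [h2, eLpNorm_one_eq_lintegral_enorm]
  refine lintegral_mono fun x => pow_le_of_le_one zero_le ?_ two_ne_zero
  rw [Real.enorm_eq_ofReal_abs]
  exact ENNReal.ofReal_le_one.2 (h x)

theorem memLp_two_of_abs_le_one {f : ℝ → ℝ} (hf : Integrable f) (h : ∀ x, |f x| ≤ 1) :
    MemLp f 2 := by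
  refine ⟨hf.1, ?_⟩
  have h1 := (eLpNorm_two_sq_le h).trans_lt (memLp_one_iff_integrable.2 hf).2
  by_contra hcon
  rw [not_lt, top_le_iff] at hcon
  simp [hcon] at h1

section Stability

variable {Z : Eulerian} {α : ℝ}

theorem stability_nonneg (hZ : IsRegular Z) (hα : α ∈ Icc (0 : ℝ) 1) (ξ : ℝ) :
    0 ≤ stability α (toLagrangian Z) ξ := by
  have := hZ.finite
  have h := deriv_charH_nonneg (Z := Z) ξ
  rw [stability_eq hZ]
  split_ifs
  · exact mul_nonneg (by linarith [hα.2]) h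
  · exact h

theorem stability_le (hZ : IsRegular Z) (hα : α ∈ Icc (0 : ℝ) 1) (ξ : ℝ) :
    stability α (toLagrangian Z) ξ ≤ deriv (charH Z) ξ := by
  have := hZ.finite
  have h := deriv_charH_nonneg (Z := Z) ξ
  rw [stability_eq hZ]
  split_ifs
  · nlinarith [hα.1]
  · exact le_rfl

theorem measurable_stability (α : ℝ) (X : Lagrangian) : Measurable (stability α X) :=
  Measurable.ite (measurableSet_lt (measurable_deriv _) measurable_const)
    ((measurable_deriv _).const_mul _) (measurable_deriv _)

theorem integrable_stability (hZ : IsRegular Z) (hα : α ∈ Icc (0 : ℝ) 1) :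
    Integrable (stability α (toLagrangian Z)) := by
  have := hZ.finite
  refine (integrable_deriv_charH Z).mono' (measurable_stability α _).aestronglyMeasurable
    (Eventually.of_forall fun ξ => ?_)
  rw [Real.norm_of_nonneg (stability_nonneg hZ hα ξ)]
  exact stability_le hZ hα ξ

theorem memLp_stability (hZ : IsRegular Z) (hα : α ∈ Icc (0 : ℝ) 1) :
    MemLp (stability α (toLagrangian Z)) 1 ∧ MemLp (stability α (toLagrangian Z)) 2 := by
  have := hZ.finite
  refine ⟨memLp_one_iff_integrable.2 (integrable_stability hZ hα),
    memLp_two_of_abs_le_one (integrable_stability hZ hα) fun ξ => ?_⟩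
  rw [abs_of_nonneg (stability_nonneg hZ hα ξ)]
  exact (stability_le hZ hα ξ).trans (deriv_charH_le_one ξ)

theorem abs_stability_sub_le_one {Z' : Eulerian} (hZ : IsRegular Z) (hZ' : IsRegular Z')
    (hα : α ∈ Icc (0 : ℝ) 1) (ξ : ℝ) :
    |stability α (toLagrangian Z) ξ - stability α (toLagrangian Z') ξ| ≤ 1 := by
  have := hZ.finite
  have := hZ'.finite
  have h1 := stability_le hZ hα ξ
  have h2 := stability_le hZ' hα ξ
  rw [abs_le]
  constructor <;>
  linarith [stability_nonneg hZ hα ξ, stability_nonneg hZ' hα ξ, deriv_charH_le_one (Z := Z) ξ,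
    deriv_charH_le_one (Z := Z') ξ]

end Stability

/-! ### Weak convergence of derivatives -/

theorem sq_integral_mul_le {m : Measure ℝ} {f g : ℝ → ℝ} (hf : MemLp f 2 m) (hg : MemLp g 2 m) :
    (∫ x, f x * g x ∂m) ^ 2 ≤ (∫ x, f x ^ 2 ∂m) * ∫ x, g x ^ 2 ∂m := by
  have hfg : Integrable (fun x => f x * g x) m := hf.integrable_mul hg
  have h : ∀ t : ℝ, 0 ≤ (∫ x, f x ^ 2 ∂m) * (t * t) + (2 * ∫ x, f x * g x ∂m) * t +
      ∫ x, g x ^ 2 ∂m := fun t => by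
    have h1 : 0 ≤ ∫ x, (t * f x + g x) ^ 2 ∂m := integral_nonneg fun x => sq_nonneg _
    have h2 : ∀ x, (t * f x + g x) ^ 2 = (t * t) * f x ^ 2 + (2 * t) * (f x * g x) + g x ^ 2 :=
      fun x => by ring
    simp only [h2] at h1
    have h3 : Integrable (fun x => (t * t) * f x ^ 2 + (2 * t) * (f x * g x)) m :=
      (hf.integrable_sq.const_mul _).add (hfg.const_mul _)
    rw [integral_add h3 hg.integrable_sq,
      integral_add (hf.integrable_sq.const_mul _) (hfg.const_mul _), integral_const_mul,
      integral_const_mul] at h1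
    linarith
  have := discrim_le_zero h
  rw [discrim] at this
  linarith

theorem integral_sq_eq {f : ℝ → ℝ} (hf : MemLp f 2) :
    ∫ x, f x ^ 2 = (eLpNorm f 2 volume).toReal ^ 2 := by
  have h1 := eLpNorm_nnreal_pow_eq_lintegral (f := f) (μ := volume) (p := 2) two_ne_zero
  simp only [ENNReal.coe_ofNat, NNReal.coe_ofNat, ENNReal.rpow_ofNat] at h1
  rw [← ENNReal.toReal_pow, h1, integral_eq_lintegral_of_nonneg_ae
    (Eventually.of_forall fun x => sq_nonneg _) hf.integrable_sq.aestronglyMeasurable]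
  congr 2
  ext x
  rw [Real.enorm_eq_ofReal_abs, ← ENNReal.ofReal_pow (abs_nonneg _), sq_abs]

theorem integral_deriv_mul_eq_neg {f φ : ℝ → ℝ} {K : NNReal} (hf : LipschitzWith K f)
    (hφ : ContDiff ℝ ∞ φ) (hc : HasCompactSupport φ) :
    ∫ x, φ x * deriv f x = -∫ x, deriv φ x * f x := by
  obtain ⟨C, hC⟩ := (hφ.of_le (by simp) : ContDiff ℝ 1 φ).lipschitzWith_of_hasCompactSupport hc
    one_ne_zero
  have h := hf.integral_lineDeriv_mul_eq (μ := volume) hC hc 1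
  have h1 : ∀ (g : ℝ → ℝ) (x : ℝ), lineDeriv ℝ g x 1 = deriv g x := fun g x => by
    simp only [lineDeriv, smul_eq_mul, mul_one]
    simpa using deriv_comp_const_add g x 0
  simp only [lineDeriv_neg, h1, neg_mul] at h
  rw [integral_neg] at h
  simpa only [mul_comm] using h

/-- If Lipschitz functions tend uniformly to zero and their derivatives are bounded in `L²`, then
the derivatives tend weakly to zero in `L²`. -/
theorem tendsto_integral_mul_deriv {f : ℝ → ℝ} (hf : MemLp f 2) {D : ℕ → ℝ → ℝ} {K : NNReal}
    {c : ℕ → ℝ} {B : ℝ} (hD : ∀ n, LipschitzWith K (D n)) (hDc : ∀ n x, |D n x| ≤ c n)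
    (hc : Tendsto c atTop (𝓝 0)) (hD2 : ∀ n, MemLp (deriv (D n)) 2)
    (hB : ∀ n, ∫ x, deriv (D n) x ^ 2 ≤ B) :
    Tendsto (fun n => ∫ x, f x * deriv (D n) x) atTop (𝓝 0) := by
  have hB0 : 0 ≤ B := (integral_nonneg fun x => sq_nonneg _).trans (hB 0)
  rw [Metric.tendsto_atTop']
  intro ε hε
  set δ : ℝ := ε / (2 * (√B + 1))
  have hδ : 0 < δ := by positivity
  obtain ⟨φ, hφc, hφ, hfφ⟩ := hf.exist_eLpNorm_sub_le (by simp) (by simp) hδ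
  have hφ2 : MemLp φ 2 := hφ.continuous.memLp_of_hasCompactSupport hφc
  have hsub : MemLp (f - φ) 2 := hf.sub hφ2
  have h1 : ∫ x, (f - φ) x ^ 2 ≤ δ ^ 2 := by
    rw [integral_sq_eq hsub]
    gcongr
    exact ENNReal.toReal_le_of_le_ofReal hδ.le hfφ
  have h2 : ∀ n, |∫ x, (f - φ) x * deriv (D n) x| ≤ δ * √B := fun n => by
    refine abs_le_of_sq_le_sq ((sq_integral_mul_le hsub (hD2 n)).trans ?_) (by positivity)
    rw [mul_pow, Real.sq_sqrt hB0]
    exact mul_le_mul h1 (hB n) (integral_nonneg fun x => sq_nonneg _) (by positivity)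
  have hφ' : Integrable (deriv φ) :=
    (hφ.continuous_deriv (by simp)).integrable_of_hasCompactSupport hφc.deriv
  have h3 : ∀ n, |∫ x, φ x * deriv (D n) x| ≤ (∫ x, |deriv φ x|) * c n := fun n => by
    rw [integral_deriv_mul_eq_neg (hD n) hφ hφc, abs_neg, ← integral_mul_const]
    refine abs_integral_le_integral_abs.trans (integral_mono_of_nonneg
      (Eventually.of_forall fun x => abs_nonneg _) (hφ'.abs.mul_const _)
      (Eventually.of_forall fun x => ?_))
    simp only [abs_mul]
    exact mul_le_mul_of_nonneg_left (hDc n x) (abs_nonneg _)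
  have h4 : Tendsto (fun n => (∫ x, |deriv φ x|) * c n) atTop (𝓝 0) := by
    simpa using hc.const_mul (∫ x, |deriv φ x|)
  have h5 : δ * √B < ε / 2 := by
    have : δ * (√B + 1) = ε / 2 := by simp only [δ]; field_simp
    linarith
  obtain ⟨N, hN⟩ := eventually_atTop.1 (h4.eventually_lt_const (half_pos hε))
  refine ⟨N, fun n hn => ?_⟩
  have h6 : ∫ x, f x * deriv (D n) x =
      (∫ x, (f - φ) x * deriv (D n) x) + ∫ x, φ x * deriv (D n) x := by
    have hi1 : Integrable fun x => (f - φ) x * deriv (D n) x := hsub.integrable_mul (hD2 n)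
    have hi2 : Integrable fun x => φ x * deriv (D n) x := hφ2.integrable_mul (hD2 n)
    rw [← integral_add hi1 hi2]
    congr 1; ext x; simp only [Pi.sub_apply]; ring
  rw [Real.dist_eq, sub_zero, h6]
  have := hN n hn.le
  exact (abs_add_le _ _).trans_lt (by linarith [h2 n, h3 n])

/-! ### Strong convergence of `(H_ξ, U_ξ)` -/

section StrongConvergence

variable {Z : Eulerian}

theorem memLp_deriv_charH (Z : Eulerian) [IsFiniteMeasure Z.ν] : MemLp (deriv (charH Z)) 2 :=
  memLp_two_of_abs_le_one (integrable_deriv_charH Z) fun ξ => by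
    rw [abs_of_nonneg (deriv_charH_nonneg ξ)]; exact deriv_charH_le_one ξ

theorem IsRegular.memLp_deriv_charU (hZ : IsRegular Z) : MemLp (deriv (charU Z)) 2 := by
  have := hZ.finite
  rw [memLp_two_iff_integrable_sq (measurable_deriv _).aestronglyMeasurable]
  refine (integrable_deriv_charH Z).mono' ((measurable_deriv _).pow_const 2).aestronglyMeasurable ?_
  filter_upwards [hZ.ae_circle] with ξ h
  rw [Real.norm_of_nonneg (sq_nonneg _)]
  nlinarith [sq_nonneg (deriv (charH Z) ξ)]

/-- Since `(H_ξ, U_ξ)` takes values in a circle, uniform convergence of `y` and `U` implies strong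
convergence of the derivatives. -/
theorem tendsto_integral_sq_sub {Zs : ℕ → Eulerian} (hZ : IsRegular Z)
    (hZs : ∀ n, IsRegular (Zs n)) (hM : ∀ n, (Zs n).ν.real univ = Z.ν.real univ) {c : ℕ → ℝ}
    (hc : Tendsto c atTop (𝓝 0)) (hy : ∀ n ξ, |charY (Zs n) ξ - charY Z ξ| ≤ c n)
    (hU : ∀ n ξ, |charU (Zs n) ξ - charU Z ξ| ≤ c n) :
    Tendsto (fun n => ∫ ξ, ((deriv (charH (Zs n)) ξ - deriv (charH Z) ξ) ^ 2 +
      (deriv (charU (Zs n)) ξ - deriv (charU Z) ξ) ^ 2)) atTop (𝓝 0) := by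
  have := hZ.finite
  have := fun n => (hZs n).finite
  set M := Z.ν.real univ
  have hdH : ∀ n, deriv (fun x => charH (Zs n) x - charH Z x) =ᵐ[volume]
      fun ξ => deriv (charH (Zs n)) ξ - deriv (charH Z) ξ := fun n => by
    filter_upwards [ae_deriv_charH (Zs n), ae_deriv_charH Z] with ξ h1 h2
    exact (h1.1.sub h2.1).deriv
  have hdU : ∀ n, deriv (fun x => charU (Zs n) x - charU Z x) =ᵐ[volume]
      fun ξ => deriv (charU (Zs n)) ξ - deriv (charU Z) ξ := fun n => by
    filter_upwards [(hZs n).ae_hasDerivAt_charU, hZ.ae_hasDerivAt_charU] with ξ h1 h2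
    exact (h1.sub h2).deriv
  have hsum : ∀ n, ∫ ξ, 2 * (deriv (charH (Zs n)) ξ + deriv (charH Z) ξ) = 4 * M := fun n => by
    rw [integral_const_mul, integral_add (integrable_deriv_charH _) (integrable_deriv_charH _),
      integral_deriv_charH, integral_deriv_charH, hM]; ring
  have hsumi : ∀ n, Integrable fun ξ => 2 * (deriv (charH (Zs n)) ξ + deriv (charH Z) ξ) :=
    fun n => ((integrable_deriv_charH _).add (integrable_deriv_charH _)).const_mul 2
  have hH : Tendsto (fun n => ∫ ξ, deriv (charH Z) ξ *
      deriv (fun x => charH (Zs n) x - charH Z x) ξ) atTop (𝓝 0) := by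
    refine tendsto_integral_mul_deriv (memLp_deriv_charH Z) (B := 4 * M)
      (fun n => (charH_lipschitz (Zs n)).sub (charH_lipschitz Z)) (fun n ξ => ?_) hc
      (fun n => ((memLp_deriv_charH _).sub (memLp_deriv_charH _)).ae_eq (hdH n).symm) fun n => ?_
    · simp only [charH]
      rw [show ξ - charY (Zs n) ξ - (ξ - charY Z ξ) = -(charY (Zs n) ξ - charY Z ξ) by ring,
        abs_neg]
      exact hy n ξ
    · rw [← hsum n]
      refine integral_mono_of_nonneg (Eventually.of_forall fun _ => sq_nonneg _) (hsumi n) ?_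
      filter_upwards [hdH n, (hZs n).ae_circle, hZ.ae_circle] with ξ h1 h2 h3
      simp only [h1]
      nlinarith [sq_nonneg (deriv (charH (Zs n)) ξ + deriv (charH Z) ξ),
        sq_nonneg (deriv (charU (Zs n)) ξ), sq_nonneg (deriv (charU Z) ξ)]
  have hU : Tendsto (fun n => ∫ ξ, deriv (charU Z) ξ *
      deriv (fun x => charU (Zs n) x - charU Z x) ξ) atTop (𝓝 0) := by
    refine tendsto_integral_mul_deriv hZ.memLp_deriv_charU (B := 4 * M)
      (fun n => (hZs n).charU_lipschitz.sub hZ.charU_lipschitz) hU hc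
      (fun n => ((hZs n).memLp_deriv_charU.sub hZ.memLp_deriv_charU).ae_eq (hdU n).symm) fun n => ?_
    rw [← hsum n]
    refine integral_mono_of_nonneg (Eventually.of_forall fun _ => sq_nonneg _) (hsumi n) ?_
    filter_upwards [hdU n, (hZs n).ae_circle, hZ.ae_circle] with ξ h1 h2 h3
    simp only [h1]
    nlinarith [sq_nonneg (deriv (charU (Zs n)) ξ + deriv (charU Z) ξ),
      sq_nonneg (deriv (charH (Zs n)) ξ), sq_nonneg (deriv (charH Z) ξ)]
  have hlim := (hH.add hU).const_mul (-2)
  rw [add_zero, mul_zero] at hlim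
  refine hlim.congr fun n => ?_
  have hi1 : Integrable fun ξ =>
      deriv (charH Z) ξ * deriv (fun x => charH (Zs n) x - charH Z x) ξ :=
    (memLp_deriv_charH Z).integrable_mul
      (((memLp_deriv_charH _).sub (memLp_deriv_charH _)).ae_eq (hdH n).symm)
  have hi2 : Integrable fun ξ =>
      deriv (charU Z) ξ * deriv (fun x => charU (Zs n) x - charU Z x) ξ :=
    hZ.memLp_deriv_charU.integrable_mul
      (((hZs n).memLp_deriv_charU.sub hZ.memLp_deriv_charU).ae_eq (hdU n).symm)
  -- The difference of the total energies vanishes.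
  have h0 : ∫ ξ, (deriv (charH (Zs n)) ξ - deriv (charH Z) ξ) = 0 := by
    rw [integral_sub (integrable_deriv_charH _) (integrable_deriv_charH _), integral_deriv_charH,
      integral_deriv_charH, hM, sub_self]
  have hi3 : Integrable fun ξ => deriv (charH (Zs n)) ξ - deriv (charH Z) ξ :=
    (integrable_deriv_charH _).sub (integrable_deriv_charH _)
  have hi4 : Integrable fun ξ => -2 *
      (deriv (charH Z) ξ * deriv (fun x => charH (Zs n) x - charH Z x) ξ +
        deriv (charU Z) ξ * deriv (fun x => charU (Zs n) x - charU Z x) ξ) :=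
    (hi1.add hi2).const_mul _
  rw [← integral_add hi1 hi2, ← integral_const_mul, ← zero_add (∫ ξ, _ * _), ← h0,
    ← integral_add hi3 hi4]
  refine integral_congr_ae ?_
  filter_upwards [hdH n, hdU n, (hZs n).ae_circle, hZ.ae_circle] with ξ h1 h2 h3 h4
  rw [h1, h2]
  linear_combination -h3 + h4

end StrongConvergence

/-! ### Weak derivatives on the line -/

/-- A test function of mean zero is the derivative of a test function. -/
theorem exists_primitive {θ : ℝ → ℝ} (hθ : ContDiff ℝ ∞ θ) (hc : HasCompactSupport θ)
    (h0 : ∫ x, θ x = 0) : ∃ φ : ℝ → ℝ, ContDiff ℝ ∞ φ ∧ HasCompactSupport φ ∧ deriv φ = θ := by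
  obtain ⟨R, hR⟩ := hc.isCompact.isBounded.subset_ball 0
  have hsupp : ∀ x, θ x ≠ 0 → -R < x ∧ x < R := fun x hx => by
    simpa [abs_lt] using hR (subset_tsupport θ hx)
  have hd : ∀ x, HasDerivAt (fun x => ∫ t in -R..x, θ t) (θ x) x := fun x =>
    intervalIntegral.integral_hasDerivAt_right (hθ.continuous.intervalIntegrable _ _)
      hθ.continuous.aestronglyMeasurable.stronglyMeasurableAtFilter hθ.continuous.continuousAt
  have hd' : deriv (fun x => ∫ t in -R..x, θ t) = θ := funext fun x => (hd x).deriv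
  refine ⟨fun x => ∫ t in -R..x, θ t, ?_, ?_, hd'⟩
  · rw [contDiff_infty_iff_deriv, hd']
    exact ⟨fun x => (hd x).differentiableAt, hθ⟩
  · refine HasCompactSupport.intro (isCompact_Icc (a := -R) (b := R)) fun x hx => ?_
    rcases lt_or_ge x (-R) with h | h
    · have : EqOn θ (fun _ => 0) (uIcc (-R) x) := fun t ht => by
        by_contra hcon
        rw [uIcc_of_ge h.le] at ht
        linarith [hsupp t hcon, ht.2]
      rw [intervalIntegral.integral_congr this]; simp
    · have hx' : R < x := by
        by_contra hcon; exact hx ⟨h, not_lt.1 hcon⟩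
      rw [intervalIntegral.integral_eq_integral_of_support_subset, h0]
      exact fun t ht => ⟨(hsupp t ht).1, ((hsupp t ht).2.trans hx').le⟩

/-- The lemma of du Bois-Reymond for continuous functions. -/
theorem eq_const_of_integral_mul_deriv_eq_zero {v : ℝ → ℝ} (hv : Continuous v)
    (h : ∀ φ : ℝ → ℝ, ContDiff ℝ ∞ φ → HasCompactSupport φ → ∫ x, v x * deriv φ x = 0) :
    ∃ c, ∀ x, v x = c := by
  let b : ContDiffBump (0 : ℝ) := ⟨1, 2, one_pos, one_lt_two⟩
  set ρ : ℝ → ℝ := b.normed volume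
  have hρ : ContDiff ℝ ∞ ρ := b.contDiff_normed
  have hρc : HasCompactSupport ρ := b.hasCompactSupport_normed
  have hρ1 : ∫ x, ρ x = 1 := b.integral_normed
  have hint : ∀ {w ψ : ℝ → ℝ}, Continuous w → Continuous ψ → HasCompactSupport ψ →
      Integrable fun x => w x * ψ x := fun hw hψ hψc =>
    (hw.mul hψ).integrable_of_hasCompactSupport hψc.mul_left
  refine ⟨∫ x, v x * ρ x, ?_⟩
  set c := ∫ x, v x * ρ x
  have key : ∀ ψ : ℝ → ℝ, ContDiff ℝ ∞ ψ → HasCompactSupport ψ → ∫ x, ψ x • (v x - c) = 0 := by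
    intro ψ hψ hψc
    have hψi : Integrable ψ := hψ.continuous.integrable_of_hasCompactSupport hψc
    have hρi : Integrable ρ := hρ.continuous.integrable_of_hasCompactSupport hρc
    obtain ⟨φ, hφ, hφc, hφd⟩ := exists_primitive (θ := fun x => ψ x - (∫ t, ψ t) * ρ x)
      (hψ.sub (contDiff_const.mul hρ)) (hψc.sub hρc.mul_left) (by
        rw [integral_sub hψi (hρi.const_mul _), integral_const_mul, hρ1]; ring)
    have h1 := h φ hφ hφc
    rw [hφd] at h1
    have h2 : ∀ x, v x * (ψ x - (∫ t, ψ t) * ρ x) = v x * ψ x - (∫ t, ψ t) * (v x * ρ x) :=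
      fun x => by ring
    simp only [h2] at h1
    rw [integral_sub (hint hv hψ.continuous hψc)
      ((hint hv hρ.continuous hρc).const_mul _), integral_const_mul] at h1
    have h3 : ∀ x, ψ x • (v x - c) = v x * ψ x - c * ψ x := fun x => by
      rw [smul_eq_mul]; ring
    simp only [h3]
    rw [integral_sub (hint hv hψ.continuous hψc) (hψi.const_mul _), integral_const_mul]
    linarith
  have hae := ae_eq_zero_of_integral_contDiff_smul_eq_zero
    (hv.sub continuous_const).locallyIntegrable key
  have : (fun x => v x - c) = fun _ => 0 :=
    (Continuous.ae_eq_iff_eq volume (hv.sub continuous_const) continuous_const).1 hae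
  intro x
  linarith [congrFun this x]

/-- A continuous function is a primitive of its weak derivative. -/
theorem HasWeakDeriv.sub_eq_integral {f f' : ℝ → ℝ} (h : HasWeakDeriv f f') (hf : Continuous f)
    (a b : ℝ) : f b - f a = ∫ x in a..b, f' x := by
  have hi : ∀ a b, IntervalIntegrable f' volume a b := fun a b =>
    intervalIntegrable_iff.2 ((h.2.1.integrableOn_isCompact isCompact_uIcc).mono_set
      uIoc_subset_uIcc)
  set P : ℝ → ℝ := fun x => ∫ t in (0 : ℝ)..x, f' t
  have hP : Continuous P := intervalIntegral.continuous_primitive hi 0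
  obtain ⟨c, hc⟩ := eq_const_of_integral_mul_deriv_eq_zero (v := fun x => f x - P x)
    (hf.sub hP) fun φ hφ hφc => by
      obtain ⟨R, hR0, hR⟩ := hφc.isCompact.isBounded.subset_ball_lt 0 0
      have hsupp : ∀ x, x ∈ tsupport φ → -R < x ∧ x < R := fun x hx => by
        simpa [abs_lt] using hR hx
      have hz : ∀ x, ¬(-R < x ∧ x < R) → φ x = 0 := fun x hx =>
        image_eq_zero_of_notMem_tsupport fun h => hx (hsupp x h)
      have hac1 : AbsolutelyContinuousOnInterval P (-R) R :=
        (hi _ _).absolutelyContinuousOnInterval_intervalIntegral (by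
          rw [uIcc_of_le (by linarith)]; constructor <;> linarith)
      have hac2 : AbsolutelyContinuousOnInterval φ (-R) R :=
        (hφ.of_le (by simp)).contDiffOn.absolutelyContinuousOnInterval
      have h1 := hac1.integral_mul_deriv_eq_deriv_mul hac2
      rw [hz R (by simp), hz (-R) (by simp), intervalIntegral.integral_eq_integral_of_support_subset
        (fun x hx => ⟨(hsupp x (support_deriv_subset (right_ne_zero_of_mul hx))).1,
          (hsupp x (support_deriv_subset (right_ne_zero_of_mul hx))).2.le⟩),
        intervalIntegral.integral_eq_integral_of_support_subset
        (fun x hx => ⟨(hsupp x (subset_tsupport _ (right_ne_zero_of_mul hx))).1,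
          (hsupp x (subset_tsupport _ (right_ne_zero_of_mul hx))).2.le⟩)] at h1
      have h2 : ∫ x, deriv P x * φ x = ∫ x, f' x * φ x := by
        refine integral_congr_ae ?_
        filter_upwards [LocallyIntegrable.ae_hasDerivAt_integral h.2.1] with x hx
        rw [(hx 0).deriv]
      have hcd : Continuous (deriv φ) := hφ.continuous_deriv (by simp)
      have h3 := h.2.2 φ hφ hφc
      have hi1 : Integrable fun x => f x * deriv φ x :=
        (hf.mul hcd).integrable_of_hasCompactSupport hφc.deriv.mul_left
      have hi2 : Integrable fun x => P x * deriv φ x :=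
        (hP.mul hcd).integrable_of_hasCompactSupport hφc.deriv.mul_left
      simp only [sub_mul]
      rw [integral_sub hi1 hi2, h1, h3, h2]
      ring
  have hab := intervalIntegral.integral_interval_sub_left (hi 0 b) (hi 0 a)
  have h1 := hc a
  have h2 := hc b
  simp only [P] at h1 h2
  linarith

theorem HasWeakDeriv.ae_hasDerivAt {f f' : ℝ → ℝ} (h : HasWeakDeriv f f') (hf : Continuous f) :
    ∀ᵐ x, HasDerivAt f (f' x) x := by
  have h1 : f = fun x => f 0 + ∫ t in (0 : ℝ)..x, f' t :=
    funext fun x => by linarith [h.sub_eq_integral hf 0 x]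
  filter_upwards [LocallyIntegrable.ae_hasDerivAt_integral h.2.1] with x hx
  rw [h1]
  exact (hx 0).const_add _

/-! ### Elements of `𝒟₀` are regular -/

theorem MemE2.continuous {f : ℝ → ℝ} (h : MemE2 f) : Continuous f := by
  obtain ⟨χp, χm, hχ, g, a, b, hg, hf⟩ := h
  have h1 := hg.1
  have h2 := hχ.smooth_p.continuous
  have h3 := hχ.smooth_m.continuous
  rw [show f = fun x => g x + a * χp x + b * χm x from funext hf]
  fun_prop

theorem acPart_le (μ : Measure ℝ) : acPart μ ≤ μ := Measure.withDensity_rnDeriv_le μ volume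

instance (μ : Measure ℝ) [IsFiniteMeasure μ] : IsFiniteMeasure (acPart μ) :=
  isFiniteMeasure_of_le μ (acPart_le μ)

namespace MemD0

variable {α : ℝ} {Z : Eulerian}

theorem isFiniteMeasure (hZ : MemD0 α Z) : IsFiniteMeasure Z.μ := hZ.1.finite_μ

/-- The Cauchy–Schwarz inequality for `u`, where only the absolutely continuous part of the energy
enters. -/
theorem sq_sub_le_ac (hZ : MemD0 α Z) {a b : ℝ} (hab : a ≤ b) :
    (Z.u b - Z.u a) ^ 2 ≤
      (b - a) * (distFun (acPart Z.μ) b - distFun (acPart Z.μ) a) := by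
  have := hZ.isFiniteMeasure
  obtain ⟨ux, hux, hac, -⟩ := hZ.1.energy
  have hm : AEStronglyMeasurable ux := hux.2.1.aestronglyMeasurable
  have hm2 : AEStronglyMeasurable (fun x => ux x ^ 2) (volume.restrict (Ico a b)) :=
    (hm.pow 2).restrict
  have h1 : ∫⁻ x in Ico a b, ENNReal.ofReal (ux x ^ 2) =
      ENNReal.ofReal (distFun (acPart Z.μ) b - distFun (acPart Z.μ) a) := by
    rw [← measure_Ico_eq_distFun hab, hac, withDensity_apply _ measurableSet_Ico]
  have h2 : ∫ x in Ico a b, ux x ^ 2 = distFun (acPart Z.μ) b - distFun (acPart Z.μ) a := by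
    rw [integral_eq_lintegral_of_nonneg_ae (Eventually.of_forall fun x => sq_nonneg _) hm2, h1,
      ENNReal.toReal_ofReal (sub_nonneg.2 (distFun_mono _ hab))]
  have h3 : MemLp ux 2 (volume.restrict (Ico a b)) := by
    rw [memLp_two_iff_integrable_sq hm.restrict]
    refine ⟨hm2, ?_⟩
    rw [hasFiniteIntegral_iff_ofReal (Eventually.of_forall fun x => sq_nonneg _), h1]
    exact ENNReal.ofReal_lt_top
  have h4 := sq_integral_mul_le h3 (memLp_const (1 : ℝ))
  rw [hux.sub_eq_integral hZ.1.u_mem.continuous, intervalIntegral.integral_of_le hab,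
    ← integral_Ico_eq_integral_Ioc]
  simp only [mul_one, h2, one_pow, integral_const, smul_eq_mul, measureReal_restrict_apply_univ,
    Real.volume_real_Ico_of_le hab] at h4
  linarith

theorem isRegular (hZ : MemD0 α Z) : IsRegular Z where
  finite := hZ.1.finite_ν
  μ_eq := hZ.2
  sq_sub_le a b hab := by
    have := hZ.isFiniteMeasure
    refine (hZ.sq_sub_le_ac hab).trans (mul_le_mul_of_nonneg_left ?_ (sub_nonneg.2 hab))
    rw [← hZ.2, ← ENNReal.ofReal_le_ofReal_iff (sub_nonneg.2 (distFun_mono _ hab)),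
      ← measure_Ico_eq_distFun hab, ← measure_Ico_eq_distFun hab]
    exact acPart_le _ _
  ae_hasDerivAt := by
    have := hZ.isFiniteMeasure
    obtain ⟨ux, hux, hac, -⟩ := hZ.1.energy
    have hm : AEMeasurable (fun x => ENNReal.ofReal (ux x ^ 2)) :=
      (hux.2.1.aestronglyMeasurable.pow 2).aemeasurable.ennreal_ofReal
    have h1 := (withDensity_eq_iff_of_sigmaFinite
      (Measure.measurable_rnDeriv Z.μ volume).aemeasurable hm).1 hac
    filter_upwards [h1, ae_hasDerivAt_distFun Z.μ, hux.ae_hasDerivAt hZ.1.u_mem.continuous]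
      with x hx hF hu
    refine ⟨ux x, hu, ?_⟩
    rwa [hx, ENNReal.toReal_ofReal (sq_nonneg _), hZ.2] at hF

end MemD0

/-! ### The projection operator -/

theorem grid_two_mul_add_one (Δx : ℝ) (j : ℤ) : grid Δx (2 * j + 1) = grid Δx (2 * j) + Δx := by
  simp only [grid]; push_cast; ring

theorem grid_two_mul_add_two (Δx : ℝ) (j : ℤ) :
    grid Δx (2 * j + 2) = grid Δx (2 * j) + 2 * Δx := by
  simp only [grid]; push_cast; ring

theorem grid_strictMono {Δx : ℝ} (h : 0 < Δx) : StrictMono (grid Δx) := fun i j hij =>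
  mul_lt_mul_of_pos_right (by exact_mod_cast hij) h

theorem cell_eq {Δx : ℝ} (h : 0 < Δx) {x : ℝ} {j : ℤ} (h1 : grid Δx (2 * j) < x)
    (h2 : x ≤ grid Δx (2 * j + 2)) : cell Δx x = j := by
  have h3 : ⌈x / (2 * Δx)⌉ = j + 1 := by
    simp only [grid] at h1 h2
    push_cast at h1 h2
    rw [Int.ceil_eq_iff, lt_div_iff₀ (by positivity), div_le_iff₀ (by positivity)]
    push_cast
    constructor <;> linarith
  rw [cell, h3]; ring

/-- The distribution function `F_{Δx} = F_{Δx,ac} + F_{Δx,sing}` of the projected measure. -/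
noncomputable def projF (Δx : ℝ) (k : ℤ → Fin 2) (Z : Eulerian) (x : ℝ) : ℝ :=
  projFac Δx k Z x + projFsing Δx Z x

/-- The expression of `u_{Δx}` on the cell `[x_{2j}, x_{2j+2}]`. -/
noncomputable def cellU (Δx : ℝ) (k : ℤ → Fin 2) (Z : Eulerian) (j : ℤ) (x : ℝ) : ℝ :=
  Z.u (grid Δx (2 * j)) + slopeLeft Δx k Z j * min (x - grid Δx (2 * j)) Δx +
    slopeRight Δx k Z j * max (x - grid Δx (2 * j) - Δx) 0

/-- The expression of `F_{Δx}` on the cell `(x_{2j}, x_{2j+2}]`. -/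
noncomputable def cellF (Δx : ℝ) (k : ℤ → Fin 2) (Z : Eulerian) (j : ℤ) (x : ℝ) : ℝ :=
  distFun (acPart Z.μ) (grid Δx (2 * j)) +
    slopeLeft Δx k Z j ^ 2 * min (x - grid Δx (2 * j)) Δx +
    slopeRight Δx k Z j ^ 2 * max (x - grid Δx (2 * j) - Δx) 0 +
    (distFun Z.μ (grid Δx (2 * j + 2)) - distFun (acPart Z.μ) (grid Δx (2 * j + 2)))

theorem hasDerivAt_cellU {Δx x p r : ℝ} {j : ℤ} (k : ℤ → Fin 2) (Z : Eulerian)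
    (hP : HasDerivAt (fun y => min (y - grid Δx (2 * j)) Δx) p x)
    (hQ : HasDerivAt (fun y => max (y - grid Δx (2 * j) - Δx) 0) r x) :
    HasDerivAt (cellU Δx k Z j) (slopeLeft Δx k Z j * p + slopeRight Δx k Z j * r) x :=
  ((hP.const_mul _).const_add _).add (hQ.const_mul _)

theorem hasDerivAt_cellF {Δx x p r : ℝ} {j : ℤ} (k : ℤ → Fin 2) (Z : Eulerian)
    (hP : HasDerivAt (fun y => min (y - grid Δx (2 * j)) Δx) p x)
    (hQ : HasDerivAt (fun y => max (y - grid Δx (2 * j) - Δx) 0) r x) :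
    HasDerivAt (cellF Δx k Z j) (slopeLeft Δx k Z j ^ 2 * p + slopeRight Δx k Z j ^ 2 * r) x :=
  (((hP.const_mul _).const_add _).add (hQ.const_mul _)).add_const _

theorem slopeLeft_add_slopeRight (Δx : ℝ) (k : ℤ → Fin 2) (Z : Eulerian) (j : ℤ) :
    slopeLeft Δx k Z j + slopeRight Δx k Z j = 2 * centralDiff Δx Z.u j := by
  rw [slopeLeft, slopeRight]; ring

theorem two_mul_centralDiff {Δx : ℝ} (h : 0 < Δx) (f : ℝ → ℝ) (j : ℤ) :
    2 * Δx * centralDiff Δx f j = f (grid Δx (2 * j + 2)) - f (grid Δx (2 * j)) := by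
  rw [centralDiff]; field_simp

theorem projU_eq_cellU {Δx : ℝ} (h : 0 < Δx) (k : ℤ → Fin 2) (Z : Eulerian) {x : ℝ} {j : ℤ}
    (h1 : grid Δx (2 * j) < x) (h2 : x ≤ grid Δx (2 * j + 2)) :
    projU Δx k Z x = cellU Δx k Z j x := by
  have hD := two_mul_centralDiff h Z.u j
  have hS := slopeLeft_add_slopeRight Δx k Z j
  simp only [projU, cell_eq h h1 h2, cellU]
  rw [grid_two_mul_add_one]
  split_ifs with hx
  · rw [min_eq_left (by linarith), max_eq_right (by linarith)]; ring
  · rw [min_eq_right (by linarith), max_eq_left (by linarith)]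
    have hg := grid_two_mul_add_two Δx j
    linear_combination -hD - slopeRight Δx k Z j * hg - Δx * hS

namespace MemD0

variable {α : ℝ} {Z : Eulerian} {Δx : ℝ} {k : ℤ → Fin 2} {j : ℤ}

/-- The Cauchy–Schwarz inequality makes the radicand in `q_{2j}` nonnegative. -/
theorem sq_qCoef (hZ : MemD0 α Z) (h : 0 < Δx) (j : ℤ) :
    qCoef Δx Z j ^ 2 =
      centralDiff Δx (distFun (acPart Z.μ)) j - centralDiff Δx Z.u j ^ 2 := by
  rw [qCoef, Real.sq_sqrt]
  have hg := grid_two_mul_add_two Δx j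
  have h1 := hZ.sq_sub_le_ac (a := grid Δx (2 * j)) (b := grid Δx (2 * j + 2)) (by linarith)
  rw [← two_mul_centralDiff h, ← two_mul_centralDiff h, hg] at h1
  have h2 : (2 * Δx) ^ 2 * centralDiff Δx Z.u j ^ 2 ≤
      (2 * Δx) ^ 2 * centralDiff Δx (distFun (acPart Z.μ)) j := by linarith
  linarith [le_of_mul_le_mul_left h2 (by positivity)]

theorem sq_slopeLeft (hZ : MemD0 α Z) (h : 0 < Δx) (k : ℤ → Fin 2) (j : ℤ) :
    slopeLeft Δx k Z j ^ 2 = centralDiff Δx (distFun (acPart Z.μ)) j +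
      (-1) ^ (k j : ℕ) * (2 * qCoef Δx Z j * centralDiff Δx Z.u j) := by
  have hσ : ((-1 : ℝ) ^ (k j : ℕ)) ^ 2 = 1 := by rw [← pow_mul, mul_comm, pow_mul]; simp
  rw [slopeLeft]
  linear_combination hZ.sq_qCoef h j + qCoef Δx Z j ^ 2 * hσ

theorem sq_slopeLeft_add (hZ : MemD0 α Z) (h : 0 < Δx) (k : ℤ → Fin 2) (j : ℤ) :
    slopeLeft Δx k Z j ^ 2 + slopeRight Δx k Z j ^ 2 =
      2 * centralDiff Δx (distFun (acPart Z.μ)) j := by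
  have hσ : ((-1 : ℝ) ^ (k j : ℕ)) ^ 2 = 1 := by rw [← pow_mul, mul_comm, pow_mul]; simp
  rw [slopeLeft, slopeRight]
  linear_combination 2 * hZ.sq_qCoef h j + 2 * qCoef Δx Z j ^ 2 * hσ

theorem projF_eq_cellF (hZ : MemD0 α Z) (h : 0 < Δx) {x : ℝ} (h1 : grid Δx (2 * j) < x)
    (h2 : x ≤ grid Δx (2 * j + 2)) : projF Δx k Z x = cellF Δx k Z j x := by
  have hD := two_mul_centralDiff h (distFun (acPart Z.μ)) j
  simp only [projF, projFac, projFsing, cell_eq h h1 h2, cellF]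
  rw [grid_two_mul_add_one]
  split_ifs with hx
  · rw [min_eq_left (by linarith), max_eq_right (by linarith)]; ring
  · rw [min_eq_right (by linarith), max_eq_left (by linarith)]
    linear_combination -(1 / 2) * hD - Δx * hZ.sq_slopeLeft h k j

theorem cellU_left (h : 0 < Δx) : cellU Δx k Z j (grid Δx (2 * j)) = Z.u (grid Δx (2 * j)) := by
  rw [cellU, min_eq_left (by linarith), max_eq_right (by linarith)]; ring

/-- The projection leaves `u` unchanged at the even grid points. -/
theorem projU_grid (h : 0 < Δx) (k : ℤ → Fin 2) (Z : Eulerian) (j : ℤ) :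
    projU Δx k Z (grid Δx (2 * j)) = Z.u (grid Δx (2 * j)) := by
  obtain ⟨i, rfl⟩ : ∃ i, j = i + 1 := ⟨j - 1, by ring⟩
  have hg := grid_two_mul_add_two Δx i
  have hD := two_mul_centralDiff h Z.u i
  have hS := slopeLeft_add_slopeRight Δx k Z i
  rw [mul_add, mul_one, projU_eq_cellU h k Z (j := i) (by linarith) le_rfl, cellU,
    min_eq_right (by linarith), max_eq_left (by linarith)]
  linear_combination hD + Δx * hS + slopeRight Δx k Z i * hg

/-- The projection leaves `F` unchanged at the even grid points. -/
theorem projF_grid (hZ : MemD0 α Z) (h : 0 < Δx) (k : ℤ → Fin 2) (j : ℤ) :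
    projF Δx k Z (grid Δx (2 * j)) = distFun Z.μ (grid Δx (2 * j)) := by
  obtain ⟨i, rfl⟩ : ∃ i, j = i + 1 := ⟨j - 1, by ring⟩
  have hg := grid_two_mul_add_two Δx i
  have hD := two_mul_centralDiff h (distFun (acPart Z.μ)) i
  have hS := hZ.sq_slopeLeft_add h k i
  rw [mul_add, mul_one, hZ.projF_eq_cellF h (j := i) (by linarith) le_rfl, cellF,
    min_eq_right (by linarith), max_eq_left (by linarith)]
  linear_combination hD + Δx * hS + slopeRight Δx k Z i ^ 2 * hg

/-- The singular part of the energy has an increasing distribution function. -/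
theorem ac_sub_le (hZ : MemD0 α Z) {a b : ℝ} (hab : a ≤ b) :
    distFun (acPart Z.μ) b - distFun (acPart Z.μ) a ≤ distFun Z.μ b - distFun Z.μ a := by
  have := hZ.isFiniteMeasure
  rw [← ENNReal.ofReal_le_ofReal_iff (sub_nonneg.2 (distFun_mono _ hab)),
    ← measure_Ico_eq_distFun hab, ← measure_Ico_eq_distFun hab]
  exact acPart_le _ _

theorem projU_eq_cellU_of_le (h : 0 < Δx) {x : ℝ} (h1 : grid Δx (2 * j) ≤ x)
    (h2 : x ≤ grid Δx (2 * j + 2)) : projU Δx k Z x = cellU Δx k Z j x := by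
  rcases h1.eq_or_lt with rfl | h1
  · rw [projU_grid h, cellU_left h]
  · exact projU_eq_cellU h k Z h1 h2

theorem projF_le_cellF (hZ : MemD0 α Z) (h : 0 < Δx) {x : ℝ} (h1 : grid Δx (2 * j) ≤ x)
    (h2 : x ≤ grid Δx (2 * j + 2)) : projF Δx k Z x ≤ cellF Δx k Z j x := by
  rcases h1.eq_or_lt with rfl | h1
  · rw [hZ.projF_grid h, cellF, min_eq_left (by linarith), max_eq_right (by linarith)]
    linarith [hZ.ac_sub_le h2]
  · exact (hZ.projF_eq_cellF h h1 h2).le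

end MemD0

/-- Monotonicity of `F` together with the Cauchy–Schwarz bound for the increment of `u`, on the
interval `[a, b]`. -/
def EnergyBound (u F : ℝ → ℝ) (a b : ℝ) : Prop :=
  F a ≤ F b ∧ (u b - u a) ^ 2 ≤ (b - a) * (F b - F a)

theorem EnergyBound.trans {u F : ℝ → ℝ} {a b c : ℝ} (hab : a ≤ b) (hbc : b ≤ c)
    (h1 : EnergyBound u F a b) (h2 : EnergyBound u F b c) : EnergyBound u F a c := by
  obtain ⟨h1, h1'⟩ := h1
  obtain ⟨h2, h2'⟩ := h2
  refine ⟨h1.trans h2, ?_⟩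
  set p := b - a
  set q := c - b
  set A := F b - F a
  set B := F c - F b
  set s := u b - u a
  set t := u c - u b
  have hp : 0 ≤ p := sub_nonneg.2 hab
  have hq : 0 ≤ q := sub_nonneg.2 hbc
  have hA : 0 ≤ A := sub_nonneg.2 h1
  have hB : 0 ≤ B := sub_nonneg.2 h2
  have h3 : s * t * 2 ≤ p * B + q * A := by
    refine le_of_sq_le_sq ?_ (by positivity)
    have := mul_le_mul h1' h2' (sq_nonneg t) (by positivity)
    nlinarith [sq_nonneg (p * B - q * A)]
  have h4 : u c - u a = s + t := by simp only [s, t]; ring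
  have h5 : c - a = p + q := by simp only [p, q]; ring
  have h6 : F c - F a = A + B := by simp only [A, B]; ring
  rw [h4, h5, h6]
  nlinarith

namespace MemD0

variable {α : ℝ} {Z : Eulerian} {Δx : ℝ} {k : ℤ → Fin 2} {j : ℤ}

theorem energyBound_cell (hZ : MemD0 α Z) (h : 0 < Δx) {a b : ℝ} (h1 : grid Δx (2 * j) ≤ a)
    (hab : a ≤ b) (h2 : b ≤ grid Δx (2 * j + 2)) :
    EnergyBound (projU Δx k Z) (projF Δx k Z) a b := by
  rcases hab.eq_or_lt with rfl | hab'
  · simp [EnergyBound]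
  have hU1 := projU_eq_cellU_of_le (Z := Z) (k := k) h h1 (hab.trans h2)
  have hU2 := projU_eq_cellU_of_le (Z := Z) (k := k) h (h1.trans hab) h2
  have hF1 := hZ.projF_le_cellF (k := k) h h1 (hab.trans h2)
  have hF2 := hZ.projF_eq_cellF (k := k) h (h1.trans_lt hab') h2
  rw [EnergyBound, hU1, hU2, hF2]
  set x₀ := grid Δx (2 * j)
  have hp : min (a - x₀) Δx ≤ min (b - x₀) Δx := by gcongr
  have hr : max (a - x₀ - Δx) 0 ≤ max (b - x₀ - Δx) 0 := by gcongr
  have hpr : ∀ x, min (x - x₀) Δx + max (x - x₀ - Δx) 0 = x - x₀ := fun x => by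
    rcases le_total (x - x₀) Δx with hx | hx
    · rw [min_eq_left hx, max_eq_right (by linarith)]; ring
    · rw [min_eq_right hx, max_eq_left (by linarith)]; ring
  have hb := hpr b
  have ha := hpr a
  set p := min (b - x₀) Δx - min (a - x₀) Δx with hp'
  set r := max (b - x₀ - Δx) 0 - max (a - x₀ - Δx) 0 with hr'
  have hp0 : 0 ≤ p := sub_nonneg.2 hp
  have hr0 : 0 ≤ r := sub_nonneg.2 hr
  set sL := slopeLeft Δx k Z j
  set sR := slopeRight Δx k Z j
  have h3 : cellF Δx k Z j b - cellF Δx k Z j a = sL ^ 2 * p + sR ^ 2 * r := by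
    simp only [cellF, p, r, sL, sR, x₀]; ring
  have h4 : cellU Δx k Z j b - cellU Δx k Z j a = sL * p + sR * r := by
    simp only [cellU, p, r, sL, sR, x₀]; ring
  have h5 : b - a = p + r := by rw [hp', hr']; linarith
  have h6 : 0 ≤ sL ^ 2 * p + sR ^ 2 * r := by positivity
  refine ⟨by linarith, ?_⟩
  calc (cellU Δx k Z j b - cellU Δx k Z j a) ^ 2 = (sL * p + sR * r) ^ 2 := by rw [h4]
    _ ≤ (p + r) * (sL ^ 2 * p + sR ^ 2 * r) := by
      nlinarith [mul_nonneg (mul_nonneg hp0 hr0) (sq_nonneg (sL - sR))]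
    _ = (b - a) * (cellF Δx k Z j b - cellF Δx k Z j a) := by rw [h3, h5]
    _ ≤ (b - a) * (cellF Δx k Z j b - projF Δx k Z a) :=
      mul_le_mul_of_nonneg_left (by linarith) (by linarith)

theorem energyBound_grid (hZ : MemD0 α Z) (h : 0 < Δx) {i j : ℤ} (hij : i ≤ j) :
    EnergyBound (projU Δx k Z) (projF Δx k Z) (grid Δx (2 * i)) (grid Δx (2 * j)) := by
  have := hZ.isFiniteMeasure
  have h1 : grid Δx (2 * i) ≤ grid Δx (2 * j) := (grid_strictMono h).monotone (by linarith)
  have h2 := hZ.isRegular.sq_sub_le _ _ h1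
  rw [← hZ.2] at h2
  rw [EnergyBound, projU_grid h, projU_grid h, hZ.projF_grid h, hZ.projF_grid h]
  exact ⟨distFun_mono _ h1, h2⟩

theorem energyBound (hZ : MemD0 α Z) (h : 0 < Δx) {a b : ℝ} (hab : a ≤ b) :
    EnergyBound (projU Δx k Z) (projF Δx k Z) a b := by
  obtain ⟨ha1, ha2⟩ := mem_cell h a
  obtain ⟨hb1, hb2⟩ := mem_cell h b
  have hij : cell Δx a ≤ cell Δx b := by
    simp only [cell]
    gcongr
  rcases hij.eq_or_lt with hij | hij
  · rw [hij] at ha1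
    exact hZ.energyBound_cell h ha1.le hab hb2
  · have h1 : grid Δx (2 * cell Δx a + 2) ≤ grid Δx (2 * cell Δx b) :=
      (grid_strictMono h).monotone (by linarith)
    refine ((hZ.energyBound_cell h ha1.le ha2 le_rfl).trans ha2 h1 ?_).trans
      (ha2.trans h1) hb1.le (hZ.energyBound_cell h le_rfl hb1.le hb2)
    have := hZ.energyBound_grid (k := k) h (i := cell Δx a + 1) (j := cell Δx b) (by linarith)
    rwa [mul_add, mul_one] at this

theorem projF_mono (hZ : MemD0 α Z) (h : 0 < Δx) (k : ℤ → Fin 2) : Monotone (projF Δx k Z) :=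
  fun _ _ hab => (hZ.energyBound h hab).1

theorem projF_nonneg (hZ : MemD0 α Z) (h : 0 < Δx) (x : ℝ) : 0 ≤ projF Δx k Z x := by
  have := hZ.projF_mono h k (mem_cell h x).1.le
  rw [hZ.projF_grid h] at this
  exact (distFun_nonneg _ _).trans this

theorem projF_le (hZ : MemD0 α Z) (h : 0 < Δx) (x : ℝ) : projF Δx k Z x ≤ Z.μ.real univ := by
  have := hZ.isFiniteMeasure
  have h1 := hZ.projF_mono h k (mem_cell h x).2
  rw [show 2 * cell Δx x + 2 = 2 * (cell Δx x + 1) by ring, hZ.projF_grid h] at h1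
  exact h1.trans (distFun_le _ _)

theorem projF_leftCont (hZ : MemD0 α Z) (h : 0 < Δx) (x : ℝ) :
    ContinuousWithinAt (projF Δx k Z) (Iic x) x := by
  obtain ⟨h1, h2⟩ := mem_cell h x
  have hc : Continuous (cellF Δx k Z (cell Δx x)) := by
    unfold cellF; fun_prop
  refine hc.continuousWithinAt.congr_of_eventuallyEq ?_ (hZ.projF_eq_cellF h h1 h2)
  filter_upwards [Ioc_mem_nhdsLE h1] with y hy
  exact hZ.projF_eq_cellF h hy.1 (hy.2.trans h2)

theorem tendsto_grid_atTop (h : 0 < Δx) :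
    Tendsto (fun n : ℕ => grid Δx (2 * (n : ℤ))) atTop atTop := by
  have : ∀ n : ℕ, grid Δx (2 * (n : ℤ)) = 2 * Δx * n := fun n => by
    simp only [grid]; push_cast; ring
  simp only [this]
  exact tendsto_natCast_atTop_atTop.const_mul_atTop (by positivity)

theorem tendsto_projF_atBot (hZ : MemD0 α Z) (h : 0 < Δx) :
    Tendsto (projF Δx k Z) atBot (𝓝 0) := by
  have := hZ.isFiniteMeasure
  have h1 : Tendsto (fun n : ℕ => grid Δx (2 * (-n : ℤ))) atTop atBot := by
    have : ∀ n : ℕ, grid Δx (2 * (-n : ℤ)) = -grid Δx (2 * (n : ℤ)) := fun n => by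
      simp only [grid]; push_cast; ring
    simp only [this]
    exact tendsto_neg_atTop_atBot.comp (tendsto_grid_atTop h)
  refine tendsto_atBot_of_comp (hZ.projF_mono h k) (hZ.projF_nonneg h) h1 ?_
  simp only [hZ.projF_grid h]
  exact tendsto_distFun_atBot.comp h1

theorem isFiniteMeasure_projMeasure (hZ : MemD0 α Z) (h : 0 < Δx) (k : ℤ → Fin 2) :
    IsFiniteMeasure (projMeasure Δx k Z) := by
  have hmono : Monotone fun x => projFac Δx k Z x + projFsing Δx Z x := hZ.projF_mono h k
  rw [projMeasure, measureOfDist, dif_pos hmono]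
  refine StieltjesFunction.isFiniteMeasure_of_forall_abs_le _ (C := Z.μ.real univ) fun x => ?_
  rw [hmono.stieltjesFunction_eq, abs_of_nonneg]
  · exact (hmono.rightLim_le (lt_add_one x)).trans (hZ.projF_le h _)
  · exact (hZ.projF_nonneg h x).trans (hmono.le_rightLim le_rfl)

theorem distFun_projMeasure (hZ : MemD0 α Z) (h : 0 < Δx) :
    distFun (projMeasure Δx k Z) = projF Δx k Z := by
  ext x
  rw [distFun, measureReal_def, show projMeasure Δx k Z = measureOfDist (projF Δx k Z) from rfl,
    measureOfDist_Iio (hZ.projF_mono h k) (hZ.projF_leftCont h) (hZ.tendsto_projF_atBot h)]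
  exact ENNReal.toReal_ofReal (hZ.projF_nonneg h x)

theorem isRegular_proj (hZ : MemD0 α Z) (h : 0 < Δx) (k : ℤ → Fin 2) :
    IsRegular (proj Δx k Z) where
  finite := hZ.isFiniteMeasure_projMeasure h k
  μ_eq := rfl
  sq_sub_le a b hab := by
    simp only [proj, hZ.distFun_projMeasure h]
    exact (hZ.energyBound h hab).2
  ae_hasDerivAt := by
    filter_upwards [(countable_range (grid Δx)).ae_notMem volume] with x hx
    simp only [proj, hZ.distFun_projMeasure h]
    obtain ⟨h1, h2⟩ := mem_cell h x
    set j := cell Δx x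
    have h2' : x < grid Δx (2 * j + 2) := h2.lt_of_ne fun hcon => hx ⟨_, hcon.symm⟩
    have hU : projU Δx k Z =ᶠ[𝓝 x] cellU Δx k Z j := by
      filter_upwards [Ioo_mem_nhds h1 h2'] with y hy using projU_eq_cellU h k Z hy.1 hy.2.le
    have hF : projF Δx k Z =ᶠ[𝓝 x] cellF Δx k Z j := by
      filter_upwards [Ioo_mem_nhds h1 h2'] with y hy using hZ.projF_eq_cellF h hy.1 hy.2.le
    have hne : x ≠ grid Δx (2 * j) + Δx := fun hcon =>
      hx ⟨2 * j + 1, by rw [grid_two_mul_add_one, hcon]⟩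
    rcases hne.lt_or_gt with h3 | h3
    · have hP : HasDerivAt (fun y => min (y - grid Δx (2 * j)) Δx) 1 x := by
        refine ((hasDerivAt_id x).sub_const (grid Δx (2 * j))).congr_of_eventuallyEq ?_
        filter_upwards [Iio_mem_nhds h3] with y hy
        exact min_eq_left (by linarith [mem_Iio.1 hy])
      have hQ : HasDerivAt (fun y => max (y - grid Δx (2 * j) - Δx) 0) 0 x := by
        refine (hasDerivAt_const x (0 : ℝ)).congr_of_eventuallyEq ?_
        filter_upwards [Iio_mem_nhds h3] with y hy
        exact max_eq_right (by linarith [mem_Iio.1 hy])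
      refine ⟨slopeLeft Δx k Z j, HasDerivAt.congr_of_eventuallyEq ?_ hU,
        HasDerivAt.congr_of_eventuallyEq ?_ hF⟩
      · simpa using hasDerivAt_cellU k Z hP hQ
      · simpa using hasDerivAt_cellF k Z hP hQ
    · have hP : HasDerivAt (fun y => min (y - grid Δx (2 * j)) Δx) 0 x := by
        refine (hasDerivAt_const x Δx).congr_of_eventuallyEq ?_
        filter_upwards [Ioi_mem_nhds h3] with y hy
        exact min_eq_right (by linarith [mem_Ioi.1 hy])
      have hQ : HasDerivAt (fun y => max (y - grid Δx (2 * j) - Δx) 0) 1 x := by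
        refine (((hasDerivAt_id x).sub_const (grid Δx (2 * j))).sub_const
          Δx).congr_of_eventuallyEq ?_
        filter_upwards [Ioi_mem_nhds h3] with y hy
        exact max_eq_left (by linarith [mem_Ioi.1 hy])
      refine ⟨slopeRight Δx k Z j, HasDerivAt.congr_of_eventuallyEq ?_ hU,
        HasDerivAt.congr_of_eventuallyEq ?_ hF⟩
      · simpa using hasDerivAt_cellU k Z hP hQ
      · simpa using hasDerivAt_cellF k Z hP hQ

/-- The projection preserves the total energy. -/
theorem real_univ_proj (hZ : MemD0 α Z) (h : 0 < Δx) (k : ℤ → Fin 2) :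
    (proj Δx k Z).ν.real univ = Z.ν.real univ := by
  have := hZ.isFiniteMeasure
  have := hZ.isFiniteMeasure_projMeasure h k
  have h1 := (tendsto_distFun_atTop (ν := projMeasure Δx k Z)).comp (tendsto_grid_atTop h)
  have h2 := (tendsto_distFun_atTop (ν := Z.μ)).comp (tendsto_grid_atTop h)
  have h3 : ∀ n : ℕ, distFun (projMeasure Δx k Z) (grid Δx (2 * (n : ℤ))) =
      distFun Z.μ (grid Δx (2 * (n : ℤ))) := fun n => by
    rw [hZ.distFun_projMeasure h, hZ.projF_grid h]
  simp only [Function.comp_def, h3] at h1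
  rw [← hZ.2]
  exact tendsto_nhds_unique h1 h2

/-- In the interior of a cell the projected measure carries no more than the absolutely
continuous energy of the cell: the singular energy is moved to the left end point. -/
theorem projMeasure_Ioo_le (hZ : MemD0 α Z) (h : 0 < Δx) (k : ℤ → Fin 2) (j : ℤ) :
    projMeasure Δx k Z (Ioo (grid Δx (2 * j)) (grid Δx (2 * j + 2))) ≤
      acPart Z.μ (Ico (grid Δx (2 * j)) (grid Δx (2 * j + 2))) := by
  have := hZ.isFiniteMeasure
  have := hZ.isFiniteMeasure_projMeasure h k
  have hg := grid_two_mul_add_two Δx j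
  set x₀ := grid Δx (2 * j)
  set x₂ := grid Δx (2 * j + 2)
  have h02 : x₀ < x₂ := by linarith
  obtain ⟨v, hv, hvx, hvl⟩ := exists_seq_strictAnti_tendsto' h02
  have hU : (⋃ n : ℕ, Ico (v n) x₂) = Ioo x₀ x₂ := by
    ext z
    simp only [mem_iUnion, mem_Ico, mem_Ioo]
    refine ⟨fun ⟨n, hn⟩ => ⟨(hvx n).1.trans_le hn.1, hn.2⟩, fun hz => ?_⟩
    obtain ⟨n, hn⟩ := (hvl.eventually_lt_const hz.1).exists
    exact ⟨n, hn.le, hz.2⟩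
  have h1 := tendsto_measure_iUnion_atTop (μ := projMeasure Δx k Z)
    (s := fun n : ℕ => Ico (v n) x₂) fun m n hmn => Ico_subset_Ico_left (hv.antitone hmn)
  rw [hU] at h1
  refine le_of_tendsto' h1 fun n => ?_
  simp only [Function.comp_apply]
  rw [measure_Ico_eq_distFun (hvx n).2.le, measure_Ico_eq_distFun h02.le,
    hZ.distFun_projMeasure h]
  refine ENNReal.ofReal_le_ofReal ?_
  have h2 : projF Δx k Z x₂ = distFun Z.μ x₂ := by
    have := hZ.projF_grid h k (j + 1)
    rwa [mul_add, mul_one] at this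
  have h3 : cellF Δx k Z j (v n) ≥ distFun (acPart Z.μ) x₀ +
      (distFun Z.μ x₂ - distFun (acPart Z.μ) x₂) := by
    have h4 : 0 ≤ slopeLeft Δx k Z j ^ 2 * min (v n - x₀) Δx :=
      mul_nonneg (sq_nonneg _) (le_min (by linarith [(hvx n).1]) h.le)
    have h5 : 0 ≤ slopeRight Δx k Z j ^ 2 * max (v n - x₀ - Δx) 0 :=
      mul_nonneg (sq_nonneg _) (le_max_right _ _)
    simp only [cellF]
    linarith
  rw [h2, hZ.projF_eq_cellF h (hvx n).1 (hvx n).2.le]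
  linarith

end MemD0

/-! ### Convergence of the Lagrangian variables -/

namespace MemD0

variable {α : ℝ} {Z : Eulerian} {Δx : ℝ}

/-- The characteristics of a triplet and of its projection lie in the same cells. -/
theorem exists_common_cell (hZ : MemD0 α Z) (h : 0 < Δx) (k : ℤ → Fin 2) (ξ : ℝ) :
    ∃ j : ℤ, charY Z ξ ∈ Ico (grid Δx (2 * j)) (grid Δx (2 * j + 2)) ∧
      charY (proj Δx k Z) ξ ∈ Ico (grid Δx (2 * j)) (grid Δx (2 * j + 2)) := by
  have := hZ.isRegular.finite
  have := (hZ.isRegular_proj h k).finite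
  have hG : ∀ i, distFun (proj Δx k Z).ν (grid Δx (2 * i)) = distFun Z.ν (grid Δx (2 * i)) :=
    fun i => by rw [proj, hZ.distFun_projMeasure h, hZ.projF_grid h, hZ.2]
  set j := ⌊charY Z ξ / (2 * Δx)⌋
  have h1 : grid Δx (2 * j) ≤ charY Z ξ := by
    have := Int.floor_le (charY Z ξ / (2 * Δx))
    rw [le_div_iff₀ (by positivity)] at this
    simp only [grid]; push_cast; linarith
  have h2 : charY Z ξ < grid Δx (2 * (j + 1)) := by
    have := Int.lt_floor_add_one (charY Z ξ / (2 * Δx))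
    rw [div_lt_iff₀ (by positivity)] at this
    simp only [grid]; push_cast; linarith
  refine ⟨j, ?_⟩
  rw [show 2 * j + 2 = 2 * (j + 1) by ring]
  refine ⟨⟨h1, h2⟩, ?_, ?_⟩
  · rw [le_charY_iff, hG, ← le_charY_iff]; exact h1
  · rw [charY_lt_iff, hG, ← charY_lt_iff]; exact h2

theorem abs_charY_proj_sub_le (hZ : MemD0 α Z) (h : 0 < Δx) (k : ℤ → Fin 2) (ξ : ℝ) :
    |charY (proj Δx k Z) ξ - charY Z ξ| ≤ 2 * Δx := by
  obtain ⟨j, hj, hj'⟩ := hZ.exists_common_cell h k ξ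
  rw [grid_two_mul_add_two] at hj hj'
  rw [abs_le]
  constructor <;> linarith [hj.1, hj.2, hj'.1, hj'.2]

theorem abs_charU_proj_sub_le (hZ : MemD0 α Z) (h : 0 < Δx) (k : ℤ → Fin 2) (ξ : ℝ) :
    |charU (proj Δx k Z) ξ - charU Z ξ| ≤ 2 * √(2 * Δx * Z.ν.real univ) := by
  obtain ⟨j, hj, hj'⟩ := hZ.exists_common_cell h k ξ
  have h1 := hZ.isRegular.abs_sub_le (grid Δx (2 * j)) (charY Z ξ)
  have h2 := (hZ.isRegular_proj h k).abs_sub_le (grid Δx (2 * j)) (charY (proj Δx k Z) ξ)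
  rw [hZ.real_univ_proj h] at h2
  have h3 : (proj Δx k Z).u (grid Δx (2 * j)) = Z.u (grid Δx (2 * j)) := projU_grid h k Z j
  rw [h3] at h2
  rw [grid_two_mul_add_two] at hj hj'
  have hmono : ∀ y, y ∈ Ico (grid Δx (2 * j)) (grid Δx (2 * j) + 2 * Δx) →
      √(|y - grid Δx (2 * j)| * Z.ν.real univ) ≤ √(2 * Δx * Z.ν.real univ) := fun y hy => by
    refine Real.sqrt_le_sqrt (mul_le_mul_of_nonneg_right ?_ measureReal_nonneg)
    rw [abs_of_nonneg (by linarith [hy.1])]; linarith [hy.2]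
  have h4 := hmono _ hj
  have h5 := hmono _ hj'
  simp only [charU]
  have h6 := abs_sub_le ((proj Δx k Z).u (charY (proj Δx k Z) ξ)) (Z.u (grid Δx (2 * j)))
    (Z.u (charY Z ξ))
  rw [abs_sub_comm (Z.u (grid Δx (2 * j)))] at h6
  linarith

/-- Let `N` be a Lebesgue null set. Most of the characteristics of `Z` that end up in `N` are, for
the projection, concentrated in grid points: cells in which `N` carries most of the energy carry
little Lebesgue measure and little absolutely continuous energy. -/
theorem tendsto_volume_sdiff (hZ : MemD0 α Z) (k : ℝ → ℤ → Fin 2) {N : Set ℝ}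
    (hNm : MeasurableSet N) (hN : volume N = 0) :
    Tendsto (fun Δx => volume (charY Z ⁻¹' N \ charY (proj Δx (k Δx) Z) ⁻¹' range (grid Δx)))
      (𝓝[>] 0) (𝓝 0) := by
  have := hZ.isRegular.finite
  have := hZ.isFiniteMeasure
  rw [ENNReal.tendsto_nhds_zero]
  intro ε hε
  have hε3 : 0 < ε / 3 := ENNReal.div_pos hε.ne' (by simp)
  obtain ⟨K, hKN, hK, hνK⟩ := hNm.exists_isCompact_sdiff_lt (measure_ne_top Z.ν N) hε3.ne'
  have hK0 : volume K = 0 := measure_mono_null hKN hN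
  obtain ⟨O₁, hKO₁, hO₁, hacO⟩ := hK.exists_isOpen_lt_of_lt (μ := acPart Z.μ) (ε / 3) (by
    rwa [acPart, withDensity_absolutelyContinuous volume (Z.μ.rnDeriv volume) hK0])
  obtain ⟨O₂, hKO₂, hO₂, hvolO⟩ := hK.exists_isOpen_lt_of_lt (μ := volume) (ε / 3) (by rwa [hK0])
  obtain ⟨δ, hδ, hKδ⟩ := hK.exists_thickening_subset_open (hO₁.inter hO₂)
    (subset_inter hKO₁ hKO₂)
  filter_upwards [Ioo_mem_nhdsGT (half_pos hδ)] with Δx hΔ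
  have h : 0 < Δx := hΔ.1
  have := (hZ.isRegular_proj h (k Δx)).finite
  set J : Set ℤ := {j | (Ico (grid Δx (2 * j)) (grid Δx (2 * j + 2)) ∩ K).Nonempty}
  set A : Set ℝ := ⋃ j ∈ J, Ioo (grid Δx (2 * j)) (grid Δx (2 * j + 2))
  set B : Set ℝ := ⋃ j ∈ J, Ico (grid Δx (2 * j)) (grid Δx (2 * j + 2))
  have hB : B ⊆ O₁ ∩ O₂ := by
    refine Subset.trans (iUnion₂_subset fun j hj x hx => ?_) hKδ
    obtain ⟨z, hz, hzK⟩ := hj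
    rw [grid_two_mul_add_two] at hx hz
    refine Metric.mem_thickening_iff.2 ⟨z, hzK, ?_⟩
    rw [Real.dist_eq, abs_lt]
    constructor <;> linarith [hx.1, hx.2, hz.1, hz.2, hΔ.2]
  have hAB : A ⊆ B := iUnion₂_mono fun j _ => Ioo_subset_Ico_self
  have hA : MeasurableSet A := .biUnion (to_countable J) fun _ _ => measurableSet_Ioo
  have hdisj : J.PairwiseDisjoint fun j => Ico (grid Δx (2 * j)) (grid Δx (2 * j + 2)) := by
    intro i _ j _ hij
    refine disjoint_left.2 fun x hi hj => hij ?_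
    have h1 := (grid_strictMono h).lt_iff_lt.1 (hi.1.trans_lt hj.2)
    have h2 := (grid_strictMono h).lt_iff_lt.1 (hj.1.trans_lt hi.2)
    omega
  have hsub : charY Z ⁻¹' N \ charY (proj Δx (k Δx) Z) ⁻¹' range (grid Δx) ⊆
      charY Z ⁻¹' (N \ K) ∪ charY (proj Δx (k Δx) Z) ⁻¹' A := by
    rintro ξ ⟨hξ, hξ'⟩
    by_cases hξK : charY Z ξ ∈ K
    · right
      obtain ⟨j, hj, hj'⟩ := hZ.exists_common_cell h (k Δx) ξ
      refine mem_iUnion₂.2 ⟨j, ⟨_, hj, hξK⟩, hj'.1.lt_of_ne fun hcon => hξ' ?_, hj'.2⟩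
      exact ⟨2 * j, hcon⟩
    · exact .inl ⟨hξ, hξK⟩
  have hνA : (proj Δx (k Δx) Z).ν A ≤ acPart Z.μ B := by
    rw [measure_biUnion (to_countable J) hdisj fun _ _ => measurableSet_Ico]
    exact (measure_biUnion_le _ (to_countable J) _).trans
      (ENNReal.tsum_le_tsum fun j => hZ.projMeasure_Ioo_le h (k Δx) j)
  calc volume (charY Z ⁻¹' N \ charY (proj Δx (k Δx) Z) ⁻¹' range (grid Δx))
      ≤ volume (charY Z ⁻¹' (N \ K)) + volume (charY (proj Δx (k Δx) Z) ⁻¹' A) :=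
        (measure_mono hsub).trans (measure_union_le _ _)
    _ = Z.ν (N \ K) + ((proj Δx (k Δx) Z).ν A + volume A) := by
        rw [volume_preimage_charY (hNm.diff hK.measurableSet), volume_preimage_charY hA,
          measure_mono_null sdiff_subset hN, add_zero]
    _ ≤ ε / 3 + (ε / 3 + ε / 3) := by
        gcongr
        · exact hνA.trans ((measure_mono (hB.trans inter_subset_left)).trans hacO.le)
        · exact (measure_mono ((hAB.trans hB).trans inter_subset_right)).trans hvolO.le
    _ = ε := by rw [← add_assoc, ENNReal.add_thirds]

end MemD0

/-! ### Convergence of the stability function -/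

/-- The stability function depends continuously on `(H_ξ, U_ξ)` in the circle, except at the
point `(1, 0)`. -/
theorem tendsto_ite_of_circle {α h w : ℝ} {hs ws : ℕ → ℝ} (hα : α ∈ Icc (0 : ℝ) 1)
    (hcirc : h ^ 2 + w ^ 2 = h) (h1 : h ≠ 1) (hs0 : ∀ n, 0 ≤ hs n)
    (hh : Tendsto hs atTop (𝓝 h)) (hw : Tendsto ws atTop (𝓝 w)) :
    Tendsto (fun n => if ws n < 0 then (1 - α) * hs n else hs n) atTop
      (𝓝 (if w < 0 then (1 - α) * h else h)) := by
  rcases lt_trichotomy w 0 with hw0 | rfl | hw0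
  · rw [if_pos hw0]
    refine (hh.const_mul _).congr' ?_
    filter_upwards [hw.eventually_lt_const hw0] with n hn
    rw [if_pos hn]
  · have h0 : h = 0 := by
      have : h * (h - 1) = 0 := by linarith
      exact (mul_eq_zero.1 this).resolve_right (sub_ne_zero.2 h1)
    subst h0
    rw [if_neg (lt_irrefl _)]
    refine squeeze_zero (fun n => ?_) (fun n => ?_) hh
    · split_ifs
      · exact mul_nonneg (by linarith [hα.2]) (hs0 n)
      · exact hs0 n
    · split_ifs
      · nlinarith [hs0 n, hα.1]
      · exact le_rfl
  · rw [if_neg hw0.not_gt]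
    refine hh.congr' ?_
    filter_upwards [hw.eventually_const_lt hw0] with n hn
    rw [if_neg hn.not_gt]

/-- A variant of the dominated convergence theorem, in which the dominating functions depend on
`n` but have the same integral as their limit. -/
theorem tendsto_integral_abs_sub {m : Measure ℝ} {g h : ℝ → ℝ} {gs hs : ℕ → ℝ → ℝ}
    (hg : Integrable g m) (hgs : ∀ n, Integrable (gs n) m) (hh : Integrable h m)
    (hhs : ∀ n, Integrable (hs n) m) (hle : ∀ n x, |gs n x - g x| ≤ hs n x + h x)
    (hint : ∀ n, ∫ x, hs n x ∂m = ∫ x, h x ∂m)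
    (hlim : ∀ᵐ x ∂m, Tendsto (fun n => hs n x) atTop (𝓝 (h x)) ∧
      Tendsto (fun n => gs n x) atTop (𝓝 (g x))) :
    Tendsto (fun n => ∫ x, |gs n x - g x| ∂m) atTop (𝓝 0) := by
  have hi1 : ∀ n, Integrable (fun x => |gs n x - g x|) m := fun n => ((hgs n).sub hg).abs
  have hi2 : ∀ n, Integrable (fun x => hs n x - h x) m := fun n => (hhs n).sub hh
  have hi3 : ∀ n, Integrable (fun x => |gs n x - g x| - (hs n x - h x)) m := fun n =>
    (hi1 n).sub (hi2 n)
  have hpos : Tendsto (fun n => ∫ x, max (|gs n x - g x| - (hs n x - h x)) 0 ∂m) atTop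
      (𝓝 (∫ _, (0 : ℝ) ∂m)) := by
    refine tendsto_integral_of_dominated_convergence (fun x => |2 * h x|)
      (fun n => ((hi3 n).pos_part).aestronglyMeasurable) (hh.const_mul 2).abs (fun n => ?_) ?_
    · refine Eventually.of_forall fun x => ?_
      rw [Real.norm_of_nonneg (le_max_right _ _)]
      exact max_le ((by linarith [hle n x] : _ ≤ 2 * h x).trans (le_abs_self _)) (abs_nonneg _)
    · filter_upwards [hlim] with x hx
      have h1 := (((hx.2.sub_const (g x)).abs).sub (hx.1.sub_const (h x))).max
        (tendsto_const_nhds (x := (0 : ℝ)))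
      simpa using h1
  rw [integral_zero] at hpos
  refine squeeze_zero (fun n => integral_nonneg fun _ => abs_nonneg _) (fun n => ?_) hpos
  have h2 : ∫ x, |gs n x - g x| ∂m = ∫ x, (|gs n x - g x| - (hs n x - h x)) ∂m := by
    rw [integral_sub (hi1 n) (hi2 n), integral_sub (hhs n) hh, hint, sub_self, sub_zero]
  rw [h2]
  exact integral_mono (hi3 n) (hi3 n).pos_part fun x => le_max_left _ _

namespace MemD0

variable {α : ℝ} {Z : Eulerian}

/-- Along a subsequence of any sequence of mesh sizes tending to zero, the derivatives `H_ξ` and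
the stability functions converge almost everywhere. -/
theorem exists_subseq_ae_tendsto (hα : α ∈ Icc (0 : ℝ) 1) (hZ : MemD0 α Z) (k : ℝ → ℤ → Fin 2)
    {d : ℕ → ℝ} (hd0 : ∀ n, 0 < d n) (hd : Tendsto d atTop (𝓝 0)) :
    ∃ ms : ℕ → ℕ, StrictMono ms ∧ ∀ᵐ ξ,
      Tendsto (fun n => deriv (charH (proj (d (ms n)) (k (d (ms n))) Z)) ξ) atTop
        (𝓝 (deriv (charH Z) ξ)) ∧
      Tendsto (fun n => stability α (toLagrangian (proj (d (ms n)) (k (d (ms n))) Z)) ξ) atTop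
        (𝓝 (stability α (toLagrangian Z) ξ)) := by
  set Zs : ℕ → Eulerian := fun n => proj (d n) (k (d n)) Z
  have hR := hZ.isRegular
  have hRs : ∀ n, IsRegular (Zs n) := fun n => hZ.isRegular_proj (hd0 n) _
  have := hR.finite
  have := fun n => (hRs n).finite
  obtain ⟨N, hNm, hN, hNae⟩ := hR.exists_null_set
  -- Convergence in `L²` of the derivatives.
  have hstrong : Tendsto (fun n => ∫ ξ, ((deriv (charH (Zs n)) ξ - deriv (charH Z) ξ) ^ 2 +
      (deriv (charU (Zs n)) ξ - deriv (charU Z) ξ) ^ 2)) atTop (𝓝 0) := by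
    have hsq : ∀ n, 0 ≤ 2 * √(2 * d n * Z.ν.real univ) := fun n => by positivity
    refine tendsto_integral_sq_sub hR hRs (fun n => hZ.real_univ_proj (hd0 n) _)
      (c := fun n => 2 * d n + 2 * √(2 * d n * Z.ν.real univ)) ?_ (fun n ξ => ?_) fun n ξ => ?_
    · have hc : Continuous fun t : ℝ => 2 * t + 2 * √(2 * t * Z.ν.real univ) := by fun_prop
      simpa [Function.comp_def] using (hc.tendsto 0).comp hd
    · exact (hZ.abs_charY_proj_sub_le (hd0 n) _ ξ).trans (by linarith [hsq n])
    · exact (hZ.abs_charU_proj_sub_le (hd0 n) _ ξ).trans (by linarith [hd0 n])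
  -- The defect collects the squared distance of the derivatives, and the set on which energy that
  -- is concentrated in the limit fails to be concentrated for the projection.
  set T : ℕ → Set ℝ := fun n => charY Z ⁻¹' N \ charY (Zs n) ⁻¹' range (grid (d n))
  have hTm : ∀ n, MeasurableSet (T n) := fun n =>
    ((charY_lipschitz Z).continuous.measurable hNm).diff
      ((charY_lipschitz (Zs n)).continuous.measurable (countable_range _).measurableSet)
  have hT : Tendsto (fun n => volume (T n)) atTop (𝓝 0) :=
    (hZ.tendsto_volume_sdiff k hNm hN).comp
      (tendsto_nhdsWithin_iff.2 ⟨hd, Eventually.of_forall hd0⟩)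
  set q : ℕ → ℝ → ℝ := fun n ξ => (deriv (charH (Zs n)) ξ - deriv (charH Z) ξ) ^ 2 +
      (deriv (charU (Zs n)) ξ - deriv (charU Z) ξ) ^ 2
  have hq0 : ∀ n ξ, 0 ≤ q n ξ := fun n ξ => by positivity
  have hqi : ∀ n, Integrable (q n) := fun n =>
    ((memLp_deriv_charH (Zs n)).sub (memLp_deriv_charH Z)).integrable_sq.add
      ((hRs n).memLp_deriv_charU.sub hR.memLp_deriv_charU).integrable_sq
  set D : ℕ → ℝ → ℝ := fun n => q n + (T n).indicator fun _ => 1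
  have hind : ∀ n, AEStronglyMeasurable ((T n).indicator fun _ => (1 : ℝ)) := fun n =>
    aestronglyMeasurable_const.indicator (hTm n)
  have hD : Tendsto (fun n => eLpNorm (D n - 0) 1 volume) atTop (𝓝 0) := by
    have h1 : Tendsto (fun n => ENNReal.ofReal (∫ ξ, q n ξ) + volume (T n)) atTop (𝓝 0) := by
      simpa using (ENNReal.tendsto_ofReal hstrong).add hT
    refine tendsto_of_tendsto_of_tendsto_of_le_of_le tendsto_const_nhds h1 (fun _ => zero_le)
      fun n => ?_
    simp only [sub_zero, D]
    refine (eLpNorm_add_le (hqi n).aestronglyMeasurable (hind n) le_rfl).trans ?_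
    gcongr
    · rw [eLpNorm_one_eq_lintegral_enorm, ← ofReal_integral_norm_eq_lintegral_enorm (hqi n)]
      simp only [Real.norm_of_nonneg (hq0 n _)]
      exact le_rfl
    · exact (eLpNorm_indicator_const_le 1 1).trans (by simp)
  obtain ⟨ms, hms, hlim⟩ := (tendstoInMeasure_of_tendsto_eLpNorm one_ne_zero
    (fun n => (hqi n).aestronglyMeasurable.add (hind n)) aestronglyMeasurable_zero
    hD).exists_seq_tendsto_ae
  have hgrid : ∀ᵐ ξ, ∀ n, charY (Zs n) ξ ∈ range (grid (d n)) → deriv (charY (Zs n)) ξ = 0 :=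
    ae_all_iff.2 fun n => ae_deriv_charY_eq_zero ((countable_range _).measure_zero _)
  have hcirc : ∀ᵐ ξ, ∀ n, deriv (charH (Zs n)) ξ ^ 2 + deriv (charU (Zs n)) ξ ^ 2 =
      deriv (charH (Zs n)) ξ := ae_all_iff.2 fun n => (hRs n).ae_circle
  have hHy : ∀ᵐ ξ, ∀ n, deriv (charH (Zs n)) ξ = 1 - deriv (charY (Zs n)) ξ :=
    ae_all_iff.2 fun n => (ae_deriv_charH (Zs n)).mono fun _ h => h.2
  refine ⟨ms, hms, ?_⟩
  filter_upwards [hlim, hgrid, hcirc, hHy, hNae] with ξ hξ hgξ hcξ hHξ hNξ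
  simp only [Pi.zero_apply] at hξ
  have hi0 : ∀ n, 0 ≤ (T n).indicator (fun _ => (1 : ℝ)) ξ := fun n =>
    indicator_nonneg (fun _ _ => zero_le_one) ξ
  have hle : ∀ {f : ℕ → ℝ} {a : ℝ}, (∀ n, (f n - a) ^ 2 ≤ D (ms n) ξ) →
      Tendsto f atTop (𝓝 a) := fun {f a} hf => by
    have h1 : Tendsto (fun n => √((f n - a) ^ 2)) atTop (𝓝 0) := by
      simpa using (squeeze_zero (fun n => sq_nonneg _) hf hξ).sqrt
    simp only [Real.sqrt_sq_eq_abs] at h1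
    exact tendsto_iff_norm_sub_tendsto_zero.2 h1
  have hH : Tendsto (fun n => deriv (charH (Zs (ms n))) ξ) atTop (𝓝 (deriv (charH Z) ξ)) :=
    hle fun n => by
      simp only [D, Pi.add_apply, q]
      linarith [hi0 (ms n), sq_nonneg (deriv (charU (Zs (ms n))) ξ - deriv (charU Z) ξ)]
  have hU : Tendsto (fun n => deriv (charU (Zs (ms n))) ξ) atTop (𝓝 (deriv (charU Z) ξ)) :=
    hle fun n => by
      simp only [D, Pi.add_apply, q]
      linarith [hi0 (ms n), sq_nonneg (deriv (charH (Zs (ms n))) ξ - deriv (charH Z) ξ)]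
  refine ⟨hH, ?_⟩
  change Tendsto (fun n => stability α (toLagrangian (Zs (ms n))) ξ) atTop _
  simp only [stability_eq (hRs _), stability_eq hR]
  by_cases hyN : charY Z ξ ∈ N
  · -- On concentrated energy the defect forces concentration of the projection, and both
    -- stability functions are equal to one.
    have h1 : deriv (charH Z) ξ = 1 := hNξ.1 hyN
    have h2 : deriv (charU Z) ξ = 0 := by
      have := hNξ.2.2
      rw [h1] at this
      exact pow_eq_zero_iff two_ne_zero |>.1 (by linarith)
    rw [h1, h2, if_neg (lt_irrefl _)]
    refine tendsto_const_nhds.congr' ?_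
    filter_upwards [hξ.eventually_lt_const zero_lt_one] with n hn
    have h3 : ξ ∉ T (ms n) := fun hcon => by
      simp only [Pi.add_apply, indicator_of_mem hcon] at hn
      linarith [hq0 (ms n) ξ]
    have h4 : charY (Zs (ms n)) ξ ∈ range (grid (d (ms n))) := by
      by_contra hcon; exact h3 ⟨hyN, hcon⟩
    have h5 : deriv (charH (Zs (ms n))) ξ = 1 := by rw [hHξ, hgξ _ h4, sub_zero]
    have h6 : deriv (charU (Zs (ms n))) ξ = 0 := by
      have := hcξ (ms n)
      rw [h5] at this
      exact pow_eq_zero_iff two_ne_zero |>.1 (by linarith)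
    rw [h5, h6, if_neg (lt_irrefl _)]
  · exact tendsto_ite_of_circle hα hNξ.2.2 (hNξ.2.1 hyN) (fun n => deriv_charH_nonneg ξ) hH hU

theorem tendsto_eLpNorm_one (hα : α ∈ Icc (0 : ℝ) 1) (hZ : MemD0 α Z) (k : ℝ → ℤ → Fin 2) :
    Tendsto (fun Δx => eLpNorm (fun ξ => stability α (toLagrangian (proj Δx (k Δx) Z)) ξ -
      stability α (toLagrangian Z) ξ) 1 volume) (𝓝[>] 0) (𝓝 0) := by
  refine tendsto_of_subseq_tendsto fun ns hns => ?_
  obtain ⟨hns0, hnspos⟩ := tendsto_nhdsWithin_iff.1 hns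
  obtain ⟨n₀, hn₀⟩ := eventually_atTop.1 hnspos
  set d : ℕ → ℝ := fun n => ns (n + n₀)
  have hd0 : ∀ n, 0 < d n := fun n => hn₀ _ (Nat.le_add_left _ _)
  obtain ⟨ms, -, hms⟩ := exists_subseq_ae_tendsto hα hZ k hd0
    (hns0.comp (tendsto_add_atTop_nat n₀))
  refine ⟨fun n => ms n + n₀, ?_⟩
  change Tendsto (fun n => eLpNorm (fun ξ =>
    stability α (toLagrangian (proj (d (ms n)) (k (d (ms n))) Z)) ξ -
      stability α (toLagrangian Z) ξ) 1 volume) atTop (𝓝 0)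
  have hR := hZ.isRegular
  have hRs : ∀ n, IsRegular (proj (d (ms n)) (k (d (ms n))) Z) := fun n =>
    hZ.isRegular_proj (hd0 _) _
  have := hR.finite
  have := fun n => (hRs n).finite
  have hlim := tendsto_integral_abs_sub (integrable_stability hR hα)
    (fun n => integrable_stability (hRs n) hα) (integrable_deriv_charH Z)
    (fun n => integrable_deriv_charH _) (fun n ξ => ?_) (fun n => ?_) hms
  · have hlim' := ENNReal.tendsto_ofReal hlim
    rw [ENNReal.ofReal_zero] at hlim'
    refine hlim'.congr fun n => ?_
    have hi := (integrable_stability (hRs n) hα).sub (integrable_stability hR hα)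
    rw [eLpNorm_one_eq_lintegral_enorm]
    exact ofReal_integral_norm_eq_lintegral_enorm hi
  · rw [abs_le]
    constructor <;>
    linarith [stability_nonneg hR hα ξ, stability_nonneg (hRs n) hα ξ, stability_le hR hα ξ,
      stability_le (hRs n) hα ξ, deriv_charH_nonneg (Z := Z) ξ,
      deriv_charH_nonneg (Z := proj (d (ms n)) (k (d (ms n))) Z) ξ]
  · rw [integral_deriv_charH, integral_deriv_charH, hZ.real_univ_proj (hd0 _)]

theorem tendsto_eLpNorm_two (hα : α ∈ Icc (0 : ℝ) 1) (hZ : MemD0 α Z) (k : ℝ → ℤ → Fin 2) :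
    Tendsto (fun Δx => eLpNorm (fun ξ => stability α (toLagrangian (proj Δx (k Δx) Z)) ξ -
      stability α (toLagrangian Z) ξ) 2 volume) (𝓝[>] 0) (𝓝 0) := by
  have h1 := (ENNReal.continuous_rpow_const (y := 1 / 2)).tendsto 0 |>.comp
    (hZ.tendsto_eLpNorm_one hα k)
  rw [ENNReal.zero_rpow_of_pos (by norm_num)] at h1
  refine tendsto_of_tendsto_of_tendsto_of_le_of_le' tendsto_const_nhds h1
    (Eventually.of_forall fun _ => zero_le) ?_
  filter_upwards [self_mem_nhdsWithin] with Δx h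
  have h2 := eLpNorm_two_sq_le
    (abs_stability_sub_le_one (hZ.isRegular_proj h (k Δx)) hZ.isRegular hα)
  rw [Function.comp_apply, one_div, ENNReal.le_rpow_inv_iff two_pos, ENNReal.rpow_ofNat]
  exact h2

end MemD0

end HunterSaxton


theorem mainTheorem5 (α : ℝ) (hα : α ∈ Set.Icc (0 : ℝ) 1)
    (Z : HunterSaxton.Eulerian) (hZ : HunterSaxton.MemD0 α Z)
    (k : ℝ → ℤ → Fin 2)
    (X : HunterSaxton.Lagrangian) (hX : X = HunterSaxton.toLagrangian Z)
    (XΔ : ℝ → HunterSaxton.Lagrangian)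
    (hXΔ : ∀ Δx, 0 < Δx →
      XΔ Δx = HunterSaxton.toLagrangian (HunterSaxton.proj Δx (k Δx) Z)) :
    (MemLp (HunterSaxton.stability α X) 1 volume ∧
      MemLp (HunterSaxton.stability α X) 2 volume) ∧
    (∀ Δx, 0 < Δx →
      MemLp (HunterSaxton.stability α (XΔ Δx)) 1 volume ∧
      MemLp (HunterSaxton.stability α (XΔ Δx)) 2 volume) ∧
    Tendsto (fun Δx : ℝ => eLpNorm
      (fun ξ => HunterSaxton.stability α (XΔ Δx) ξ - HunterSaxton.stability α X ξ) 1 volume)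
      (𝓝[>] 0) (𝓝 0) ∧
    Tendsto (fun Δx : ℝ => eLpNorm
      (fun ξ => HunterSaxton.stability α (XΔ Δx) ξ - HunterSaxton.stability α X ξ) 2 volume)
      (𝓝[>] 0) (𝓝 0) := by
  subst hX
  refine ⟨HunterSaxton.memLp_stability hZ.isRegular hα, fun Δx h => ?_, ?_, ?_⟩
  · rw [hXΔ Δx h]
    exact HunterSaxton.memLp_stability (hZ.isRegular_proj h _) hα
  · refine (hZ.tendsto_eLpNorm_one hα k).congr' ?_
    filter_upwards [self_mem_nhdsWithin] with Δx h
    rw [hXΔ Δx h]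
  · refine (hZ.tendsto_eLpNorm_two hα k).congr' ?_
    filter_upwards [self_mem_nhdsWithin] with Δx h
    rw [hXΔ Δx h]
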